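/- **Setting.** Let $U_2$ be a finite-dimensional unitary matrix with real entries whose $1$-eigenspace is one-dimensional, spanned by the real unit vector $|\phi_0\rangle$; let $|\mu\rangle$ be a real unit vector, $U_1=I-2|\mu\rangle\langle\mu|$, $U=U_2U_1$, and $|\tilde\phi_0\rangle=|\phi_0\rangle-\langle\phi_0|\mu\rangle|\mu\rangle$. Let $e^{\pm i\alpha_j}$, $0<\alpha_j<\pi$, be the distinct non-real eigenvalues of $U$, and write $$|\tilde\phi_0\rangle=\delta_0|w_0\rangle+\sum_j\delta_j\bigl(|w_j^+\rangle+|w_j^-\rangle\bigr)+\delta_{-1}|w_{-1}\rangle$$ with $\delta$'s real and $|w_0\rangle,|w_j^{\pm}\rangle,|w_{-1}\rangle$ unit eigenvectors of $U$ for the eigenvalues $1$, $e^{\pm i\alpha_j}$, $-1$, where $|w_j^-\rangle=\overline{|w_j^+\rangle}$. The $U$-rotation of $|\tilde\phi_0\rangle$ is $\delta_0|w_0\rangle+\sum_j\delta_j(|w_j^+\rangle-|w_j^-\rangle)+\delta_{-1}|w_{-1}\rangle$. Let $QH$ take the value $1/\alpha_j$ with probability $2\delta_j^2$, the value $1/\pi$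 with probability $\delta_{-1}^2$, and the value $0$ otherwise, and for $0<\varepsilon<1$ let $$\mathsf{QHT}_\varepsilon(U_2,|\mu\rangle)=\min\{y\ge 0:\Pr[QH>y]\le\varepsilon\}.$$ **Procedure.** For constants $a,b>0$, $\mathrm{Rotate}(U,\Delta,\varepsilon)$ is the following circuit, which accesses $U$ only through applications of controlled-$U$ and its inverse. It uses $k=\lfloor a\log(1/\varepsilon)\rfloor$ ancilla registers of $m$ qubits each, all initialised to $0$, where $m\geq 0$ is the least integer with $2^m\ge b/\Delta$. 1. On each register perform phase estimation of $U$ on the same input state: Hadamard gates on all $m$ qubits, then for each $i<m$ the operator $U^{2^i}$ controlled by qubit $i$, carried out as $2^i$ applications of controlled-$U$, then the inverse quantum Fourier transform modulo $2^m$. The content $y\in\{0,\dots,2^m-1\}$ of a register stands for the estimated phase in $(-\pi,\pi]$ congruent to $2\pi y/2^m$ modulo $2\pi$. 2. Multiply by $-1$ the ancilla basis states in which more than $k/2$ of the estimated phases are negative. 3. Undo step 1. **Theorem.** There are absolute constants $a_0,b_0>0$ such that for all $a\ge a_0$ and $b\ge b_0$ there is $C>0$, depending only on $a,b$, with the following property.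 Let $U_2,|\phi_0\rangle,|\mu\rangle$ be as above, in any finite dimension, assume that every eigenvalue $e^{i\alpha}$ of $U$, $\alpha\in(-\pi,\pi]$, satisfies $|\alpha|\le\pi/2$, and let $0<\varepsilon<1$ and $T>0$ with $T\ge\mathsf{QHT}_\varepsilon(U_2,|\mu\rangle)$. Then $\mathrm{Rotate}(U,1/T,\varepsilon)$ maps $|\tilde\phi_0\rangle|0\cdots0\rangle$ to a vector within Euclidean distance $C\sqrt\varepsilon$ of $|\psi\rangle|0\cdots0\rangle$, where $|\psi\rangle$ is the $U$-rotation of $|\tilde\phi_0\rangle$, and it uses at most $C\log(1/\varepsilon)\,T$ applications of controlled-$U$ and its inverse in total. In particular, for $T=\mathsf{QHT}_\varepsilon(U_2,|\mu\rangle)>0$ this number is $O(\log(1/\varepsilon)\cdot\mathsf{QHT}_\varepsilon(U_2,|\mu\rangle))$. -/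

import Mathlib

open MeasureTheory
open scoped Matrix Kronecker

namespace QuantumSearch

noncomputable section

universe u

/-! ### Spectral notions for a matrix `U` acting on `ℂ^ι` -/

section Spectral

variable {ι : Type u} [Fintype ι] [DecidableEq ι]

/-- The `z`-eigenspace of `U` (the zero subspace if `z` is not an eigenvalue). -/
def eigenspace (U : Matrix ι ι ℂ) (z : ℂ) : Submodule ℂ (EuclideanSpace ℂ ι) :=
  Module.End.eigenspace (Matrix.toEuclideanLin U) z

/-- The component of `ψ` in the `z`-eigenspace of `U`: the orthogonal projection of `ψ`. -/
def eigencomponent (U : Matrix ι ι ℂ) (z : ℂ) (ψ : EuclideanSpace ℂ ι) : EuclideanSpace ℂ ι :=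
  (eigenspace U z).starProjection ψ

/-- The eigenvalues `z_j = e^{i α_j}` of `U` in the open upper half plane.
For unitary `U` their phases are the `α_j = arg z_j ∈ (0, π)`. -/
def upperEigenvalues (U : Matrix ι ι ℂ) : Finset ℂ :=
  (Module.End.finite_hasEigenvalue (Matrix.toEuclideanLin U)).toFinset.filter (fun z => 0 < z.im)

/-- All eigenphases `α ∈ (-π, π]` of `U` satisfy `|α| ≤ π / 2`. -/
def PhasesAtMostHalfPi (U : Matrix ι ι ℂ) : Prop :=
  ∀ z : ℂ, Module.End.HasEigenvalue (Matrix.toEuclideanLin U) z → |z.arg| ≤ Real.pi / 2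

/-- The `U`-rotation of `ψ`. With
`ψ = δ_0 w_0 + ∑_j δ_j (w_j^+ + w_j^-) + δ_{-1} w_{-1}`, where `w_0`, `w_j^±`, `w_{-1}` are unit
eigenvectors for `1`, `e^{± i α_j}`, `-1`, this is
`δ_0 w_0 + ∑_j δ_j (w_j^+ - w_j^-) + δ_{-1} w_{-1}`.
Here `δ_j w_j^±` is the component of `ψ` in the eigenspace of `e^{± i α_j}`. -/
def rotation (U : Matrix ι ι ℂ) (ψ : EuclideanSpace ℂ ι) : EuclideanSpace ℂ ι :=
  eigencomponent U 1 ψ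
    + ∑ z ∈ upperEigenvalues U,
        (eigencomponent U z ψ - eigencomponent U ((starRingEnd ℂ) z) ψ)
    + eigencomponent U (-1) ψ

/-- The law of the random variable `QH` of `U` and (real) `ψ`: value `1 / α_j` with probability
`2 δ_j²`, value `1 / π` with probability `δ_{-1}²`, and value `0` otherwise. Since `ψ` need not be
normalized, the total mass is `‖ψ‖²`; here `δ_j² = ‖δ_j w_j^+‖²`. -/
def lawQH (U : Matrix ι ι ℂ) (ψ : EuclideanSpace ℂ ι) : Measure ℝ :=
  (∑ z ∈ upperEigenvalues U,
      ENNReal.ofReal (2 * ‖eigencomponent U z ψ‖ ^ 2) • Measure.dirac (1 / z.arg))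
    + ENNReal.ofReal (‖eigencomponent U (-1) ψ‖ ^ 2) • Measure.dirac (1 / Real.pi)
    + ENNReal.ofReal (‖eigencomponent U 1 ψ‖ ^ 2) • Measure.dirac 0

end Spectral

/-! ### Abstract search algorithms and the quantum hitting time -/

/-- An abstract search algorithm: a real unitary matrix `U₂` whose `1`-eigenspace is the line
spanned by the real unit vector `φ₀`, and a real unit target vector `μ`. -/
structure AbstractSearch (ι : Type u) [Fintype ι] [DecidableEq ι] where
  U₂ : Matrix ι ι ℝ
  U₂_mem : U₂ ∈ Matrix.orthogonalGroup ι ℝ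
  φ₀ : EuclideanSpace ℝ ι
  norm_φ₀ : ‖φ₀‖ = 1
  fixed : Matrix.toEuclideanLin U₂ φ₀ = φ₀
  unique : ∀ v : EuclideanSpace ℝ ι, Matrix.toEuclideanLin U₂ v = v → ∃ c : ℝ, v = c • φ₀
  μ : EuclideanSpace ℝ ι
  norm_μ : ‖μ‖ = 1

namespace AbstractSearch

variable {ι : Type u} [Fintype ι] [DecidableEq ι]

/-- `U₁ = I - 2 |μ⟩⟨μ|`. -/
def U₁ (S : AbstractSearch ι) : Matrix ι ι ℝ :=
  1 - (2 : ℝ) • Matrix.vecMulVec (fun i => S.μ i) (fun i => S.μ i)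

/-- `U = U₂ U₁`, as a complex matrix. -/
def U (S : AbstractSearch ι) : Matrix ι ι ℂ :=
  (S.U₂ * S.U₁).map (fun x : ℝ => (x : ℂ))

/-- The starting vector `φ̃₀ = φ₀ - ⟨φ₀, μ⟩ μ`, as a complex vector. -/
def start (S : AbstractSearch ι) : EuclideanSpace ℂ ι :=
  WithLp.toLp 2 (fun i => (((S.φ₀ - (inner ℝ S.φ₀ S.μ) • S.μ) i : ℝ) : ℂ))

/-- The quantum `ε`-error hitting time
`QHT_ε(U₂, μ) = min {y ≥ 0 : Pr[QH > y] ≤ ε}`, for the starting vector `φ̃₀`. -/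
def hittingTime (S : AbstractSearch ι) (ε : ℝ) : ℝ :=
  sInf {y : ℝ | 0 ≤ y ∧ lawQH S.U S.start (Set.Ioi y) ≤ ENNReal.ofReal ε}

/-- The infimum in the definition of the hitting time is a minimum. -/
theorem hittingTime_isLeast (S : AbstractSearch ι) {ε : ℝ} (hε : 0 < ε) :
    IsLeast {y : ℝ | 0 ≤ y ∧ lawQH S.U S.start (Set.Ioi y) ≤ ENNReal.ofReal ε}
      (S.hittingTime ε) := by
  have hfin : IsFiniteMeasure (lawQH S.U S.start) := by
    refine ⟨?_⟩
    simp only [lawQH, one_div, Measure.coe_add, Measure.coe_finset_sum, Pi.add_apply,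
      Finset.sum_apply, Measure.smul_apply, smul_eq_mul, measure_univ, mul_one]
    refine ENNReal.add_lt_top.mpr ⟨ENNReal.add_lt_top.mpr ⟨?_, ENNReal.ofReal_lt_top⟩,
      ENNReal.ofReal_lt_top⟩
    exact ENNReal.sum_lt_top.mpr fun z _ => ENNReal.ofReal_lt_top
  set A : Set ℝ := {y : ℝ | 0 ≤ y ∧ lawQH S.U S.start (Set.Ioi y) ≤ ENNReal.ofReal ε} with hA
  have hbdd : BddBelow A := ⟨0, fun y hy => hy.1⟩
  have hne : A.Nonempty := by
    have h := tendsto_measure_iInter_atTop (μ := lawQH S.U S.start)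
      (s := fun n : ℕ => Set.Ioi (n : ℝ)) (fun n => measurableSet_Ioi.nullMeasurableSet)
      (fun i j hij => Set.Ioi_subset_Ioi (by exact_mod_cast hij)) ⟨0, measure_ne_top _ _⟩
    have h0 : (⋂ n : ℕ, Set.Ioi (n : ℝ)) = ∅ := by
      ext x
      obtain ⟨n, hn⟩ := exists_nat_ge x
      simp only [Set.mem_iInter, Set.mem_Ioi, Set.mem_empty_iff_false, iff_false, not_forall,
        not_lt]
      exact ⟨n, hn⟩
    rw [h0, measure_empty] at h
    obtain ⟨n, hn⟩ := (h.eventually_lt_const (ENNReal.ofReal_pos.mpr hε)).exists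
    exact ⟨n, Nat.cast_nonneg n, hn.le⟩
  refine ⟨⟨le_csInf hne fun y hy => hy.1, ?_⟩, fun y hy => csInf_le hbdd hy⟩
  obtain ⟨u, hu, -, hlim, hmem⟩ := (isGLB_csInf hne hbdd).exists_seq_antitone_tendsto hne
  have hU : Set.Ioi (sInf A) = ⋃ n, Set.Ioi (u n) := by
    ext x
    simp only [Set.mem_Ioi, Set.mem_iUnion]
    refine ⟨fun hx => (hlim.eventually_lt_const hx).exists, ?_⟩
    rintro ⟨n, hn⟩
    exact (csInf_le hbdd (hmem n)).trans_lt hn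
  change lawQH S.U S.start (Set.Ioi (sInf A)) ≤ _
  have hmono : Monotone (fun n => Set.Ioi (u n)) := fun i j hij => Set.Ioi_subset_Ioi (hu hij)
  rw [hU, hmono.measure_iUnion]
  exact iSup_le fun n => (hmem n).2

end AbstractSearch

/-! ### Circuits with controlled applications of `U`

The workspace consists of `k` registers of `m` qubits each; circuits act on `ℂ^ι ⊗ ℂ^(Work k m)`. -/

/-- Computational basis states of a register of `m` qubits. -/
abbrev Reg (m : ℕ) : Type := Fin m → Bool

/-- Computational basis states of `k` registers of `m` qubits. -/
abbrev Work (k m : ℕ) : Type := Fin k → Reg m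

/-- The elementary steps: an operator `W` on the workspace alone, or one application of `U`,
respectively of its inverse, controlled by the `i`-th qubit of register `r`. -/
inductive Gate (k m : ℕ) : Type
  | work (W : Matrix (Work k m) (Work k m) ℂ) : Gate k m
  | ctrl (r : Fin k) (i : Fin m) : Gate k m
  | ctrlInv (r : Fin k) (i : Fin m) : Gate k m

namespace Gate

variable {ι : Type u} [Fintype ι] [DecidableEq ι] {k m : ℕ}

/-- The operator performed by a gate (`Uᴴ` is the inverse of the unitary `U`). -/
def mat (U : Matrix ι ι ℂ) : Gate k m → Matrix (ι × Work k m) (ι × Work k m) ℂ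
  | work W => (1 : Matrix ι ι ℂ) ⊗ₖ W
  | ctrl r i => Matrix.blockDiagonal (fun x : Work k m => if x r i = true then U else 1)
  | ctrlInv r i => Matrix.blockDiagonal (fun x : Work k m => if x r i = true then Uᴴ else 1)

/-- The number of applications of controlled-`U` or its inverse in a gate. -/
def calls : Gate k m → ℕ
  | work _ => 0
  | ctrl _ _ => 1
  | ctrlInv _ _ => 1

/-- The adjoint gate. -/
def adjoint : Gate k m → Gate k m
  | work W => work Wᴴ
  | ctrl r i => ctrlInv r i
  | ctrlInv r i => ctrl r i

end Gate

/-- A circuit: a list of gates, the head being performed first. -/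
abbrev Circuit (k m : ℕ) : Type := List (Gate k m)

namespace Circuit

variable {ι : Type u} [Fintype ι] [DecidableEq ι] {k m : ℕ}

/-- The operator performed by a circuit. -/
def mat (U : Matrix ι ι ℂ) : Circuit k m → Matrix (ι × Work k m) (ι × Work k m) ℂ
  | [] => 1
  | g :: c => mat U c * g.mat U

/-- The number of applications of controlled-`U` and its inverse in a circuit. -/
def calls (c : Circuit k m) : ℕ := (c.map Gate.calls).sum

/-- The circuit undoing `c` (for a circuit of unitary gates). -/
def undo (c : Circuit k m) : Circuit k m := (c.map Gate.adjoint).reverse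

/-- The state to which the circuit, for the operator `U`, takes a state. -/
def run (U : Matrix ι ι ℂ) (c : Circuit k m) (Ψ : EuclideanSpace ℂ (ι × Work k m)) :
    EuclideanSpace ℂ (ι × Work k m) :=
  Matrix.toEuclideanLin (mat U c) Ψ

end Circuit

/-- The state `ψ ⊗ |0…0⟩`. -/
def withZeros {ι : Type u} [Fintype ι] (k m : ℕ) (ψ : EuclideanSpace ℂ ι) :
    EuclideanSpace ℂ (ι × Work k m) :=
  WithLp.toLp 2 (fun p => if p.2 = (fun _ _ => false) then ψ p.1 else 0)

/-! ### Phase estimation -/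

/-- The integer in `{0, …, 2^m - 1}` written in a register. -/
def regValue {m : ℕ} (x : Reg m) : ℕ := ∑ i : Fin m, if x i = true then 2 ^ (i : ℕ) else 0

/-- A Hadamard gate on each of `m` qubits. -/
def hadamard (m : ℕ) : Matrix (Reg m) (Reg m) ℂ :=
  fun y x => ∏ i : Fin m, (if y i = true ∧ x i = true then (-1 : ℂ) else 1) / (Real.sqrt 2 : ℂ)

/-- The inverse quantum Fourier transform modulo `2^m`. -/
def invQFT (m : ℕ) : Matrix (Reg m) (Reg m) ℂ :=
  fun y x => Complex.exp (-(2 * Real.pi * Complex.I * (regValue x : ℂ) * (regValue y : ℂ) / 2 ^ m))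
    / (Real.sqrt (2 ^ m) : ℂ)

/-- The operator `V` applied to register `r`, the identity on the others. -/
def onRegister {k m : ℕ} (r : Fin k) (V : Matrix (Reg m) (Reg m) ℂ) :
    Matrix (Work k m) (Work k m) ℂ :=
  fun y x => if ∀ s, s ≠ r → y s = x s then V (y r) (x r) else 0

/-- The phase estimation circuit on register `r`: Hadamard gates, then for each `i < m` the
operator `U^(2^i)` controlled by qubit `i` (as `2^i` applications of controlled-`U`), then the
inverse Fourier transform. -/
def estimate {k m : ℕ} (r : Fin k) : Circuit k m :=
  [Gate.work (onRegister r (hadamard m))]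
    ++ (List.finRange m).flatMap (fun i : Fin m =>
        List.replicate (2 ^ (i : ℕ)) (Gate.ctrl r i))
    ++ [Gate.work (onRegister r (invQFT m))]

/-- The phase in `(-π, π]` that a register content stands for:
`2 π y / 2^m` modulo `2 π`, where `y` is the value of the register. -/
def estimatedPhase {m : ℕ} (x : Reg m) : ℝ :=
  if 2 * regValue x ≤ 2 ^ m then 2 * Real.pi * regValue x / 2 ^ m
  else 2 * Real.pi * regValue x / 2 ^ m - 2 * Real.pi

/-- The phase flip on the basis states in which more than half of the `k` estimated phases are
negative. -/
def majorityFlip (k m : ℕ) : Matrix (Work k m) (Work k m) ℂ :=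
  Matrix.diagonal (fun x =>
    if k < 2 * (Finset.univ.filter (fun r : Fin k => estimatedPhase (x r) < 0)).card
    then -1 else 1)

/-- `k` phase estimations with `m` qubits each on the same state, the phase flip if the majority of
the estimated phases are negative, and the undoing of the phase estimations. -/
def rotateCircuit (k m : ℕ) : Circuit k m :=
  let estimates : Circuit k m := (List.finRange k).flatMap estimate
  estimates ++ [Gate.work (majorityFlip k m)] ++ Circuit.undo estimates

/-- The number of repetitions of phase estimation, `Θ(log (1 / ε))` with constant `a`. -/
def repetitions (a ε : ℝ) : ℕ := ⌊a * Real.log (1 / ε)⌋₊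

/-- The number of qubits of phase estimation with precision `Δ`: the least `m` with
`b / Δ ≤ 2^m`, where `b` is a constant, so that the spacing `2 π / 2^m` of the estimates is at most
`2 π Δ / b`. -/
def qubits (b Δ : ℝ) : ℕ := Nat.clog 2 ⌈b / Δ⌉₊

/-- The procedure `Rotate(U, Δ, ε)`, with constants `a` for the number of repetitions and `b` for
the precision. It accesses `U` only through controlled applications. -/
def Rotate (a b Δ ε : ℝ) : Circuit (repetitions a ε) (qubits b Δ) :=
  rotateCircuit (repetitions a ε) (qubits b Δ)

end

end QuantumSearch

/-! Everything reduces to single eigenvectors. `U` is unitary, so its eigenspaces are pairwise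
orthogonal and span the space. On `w ⊗ χ` with `w` an eigenvector for `z`, a controlled `U` only
multiplies workspace amplitudes by `z` or `1`; the circuit therefore keeps `w` and acts on `χ` by a
matrix depending on `z` alone (`Circuit.run_tensor`). The `U`-rotation is the sign of the phase on
each eigenspace, because the phase bound excludes the eigenvalue `-1`. By Pythagoras the squared
error is the sum, over the eigenvalues `z`, of the weight of the start vector at `z` times the
squared `rotationDefect` (`norm_sq_run_sub_rotation`).

For fixed `z` the workspace matrix is `Eᴴ F E`, where `E` is the isometry of all phase estimations
and `F` the majority flip. The defect is `Eᴴ (F - sign) E` on the zero state, so its squared norm is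
at most `4` times the probability that at least half of `k` independent readings have the wrong
sign. There are three cases. If `2^m |α|` is at least `74π`, one reading errs with probability at
most `1/16` (`sum_misread_le`), and an exponential moment bound gives `2⁻ᵏ` for the majority
(`sum_prod_majority_le`). If `z = 1`, phase estimation is exact. If `0 < |α| < 1/T`, only the
trivial bound `4` is used, but the definition of the hitting time makes the total weight of these
eigenvalues at most `ε` (`sum_small_phases_le`).

Since `2⁻ᵏ ≤ 2ε`, the squared error is `O(ε)`. The cost is exactly `2k(2^m - 1)`, with `k = O(log
(1/ε))` and `2^m - 1 = O(T)`. -/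

namespace QuantumSearch

noncomputable section

universe u

/-! ### Circuits acting on an eigenvector -/

section ScalarMatrix

variable {k m : ℕ}

/-- The action of a gate on the workspace when `U` is replaced by the scalar `z`. -/
def Gate.scalarMat (z : ℂ) : Gate k m → Matrix (Work k m) (Work k m) ℂ
  | .work W => W
  | .ctrl r i => Matrix.diagonal (fun x => if x r i = true then z else 1)
  | .ctrlInv r i => Matrix.diagonal (fun x => if x r i = true then star z else 1)

/-- The action of a circuit on the workspace when `U` is replaced by the scalar `z`. -/
def Circuit.scalarMat (z : ℂ) : Circuit k m → Matrix (Work k m) (Work k m) ℂ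
  | [] => 1
  | g :: c => Circuit.scalarMat z c * g.scalarMat z

theorem Circuit.scalarMat_append (z : ℂ) (c d : Circuit k m) :
    Circuit.scalarMat z (c ++ d) = Circuit.scalarMat z d * Circuit.scalarMat z c := by
  induction c with
  | nil => simp [Circuit.scalarMat]
  | cons g c ih => simp [Circuit.scalarMat, ih, Matrix.mul_assoc]

theorem Gate.scalarMat_adjoint (z : ℂ) (g : Gate k m) :
    g.adjoint.scalarMat z = (g.scalarMat z)ᴴ := by
  cases g with
  | work W => rfl
  | ctrl r i =>
    rw [Gate.adjoint, Gate.scalarMat, Gate.scalarMat, Matrix.diagonal_conjTranspose]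
    congr 1
    ext x
    rw [Pi.star_apply]
    split_ifs <;> simp
  | ctrlInv r i =>
    rw [Gate.adjoint, Gate.scalarMat, Gate.scalarMat, Matrix.diagonal_conjTranspose]
    congr 1
    ext x
    rw [Pi.star_apply]
    split_ifs <;> simp

theorem Circuit.scalarMat_undo (z : ℂ) (c : Circuit k m) :
    Circuit.scalarMat z c.undo = (Circuit.scalarMat z c)ᴴ := by
  induction c with
  | nil => simp [Circuit.scalarMat, Circuit.undo]
  | cons g c ih =>
    have h : Circuit.undo (g :: c) = Circuit.undo c ++ [g.adjoint] := by simp [Circuit.undo]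
    rw [h, Circuit.scalarMat_append, ih]
    simp [Circuit.scalarMat, Gate.scalarMat_adjoint, Matrix.conjTranspose_mul]

end ScalarMatrix

/-! ### Operators on one register -/

section OnRegister

variable {k m : ℕ}

/-- Splitting register `r` off the others turns the operator into `V ⊗ 1`, so its algebra is
inherited from the Kronecker product. -/
theorem onRegister_eq_submatrix (r : Fin k) (V : Matrix (Reg m) (Reg m) ℂ) :
    onRegister r V = (V ⊗ₖ (1 : Matrix ({s // s ≠ r} → Reg m) ({s // s ≠ r} → Reg m) ℂ)).submatrix
      (Equiv.funSplitAt r (Reg m)) (Equiv.funSplitAt r (Reg m)) := by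
  ext y x
  have h : (∀ s, s ≠ r → y s = x s) ↔
      ((fun s : {s // s ≠ r} => y s) = fun s : {s // s ≠ r} => x s) := by
    simp [funext_iff]
  simp [onRegister, Matrix.one_apply, h]

theorem onRegister_mul (r : Fin k) (V W : Matrix (Reg m) (Reg m) ℂ) :
    onRegister r V * onRegister r W = onRegister r (V * W) := by
  simp only [onRegister_eq_submatrix]
  rw [Matrix.submatrix_mul_equiv, ← Matrix.mul_kronecker_mul, Matrix.one_mul]

theorem onRegister_one (r : Fin k) : onRegister r (1 : Matrix (Reg m) (Reg m) ℂ) = 1 := by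
  rw [onRegister_eq_submatrix, Matrix.one_kronecker_one, Matrix.submatrix_one_equiv]

theorem onRegister_conjTranspose (r : Fin k) (V : Matrix (Reg m) (Reg m) ℂ) :
    (onRegister r V)ᴴ = onRegister r Vᴴ := by
  simp only [onRegister_eq_submatrix]
  rw [Matrix.conjTranspose_submatrix, Matrix.conjTranspose_kronecker, Matrix.conjTranspose_one]

theorem onRegister_diagonal (r : Fin k) (d : Reg m → ℂ) :
    onRegister r (Matrix.diagonal d) = Matrix.diagonal (fun x : Work k m => d (x r)) := by
  ext y x
  by_cases h : y = x
  · subst h; simp [onRegister]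
  · rw [Matrix.diagonal_apply_ne _ h, onRegister]
    split_ifs with h1
    · refine Matrix.diagonal_apply_ne _ fun h2 => h (funext fun s => ?_)
      by_cases hs : s = r
      · rw [hs, h2]
      · exact h1 s hs
    · rfl

/-- Product states stay products. This is what makes the `k` phase readings independent when the
input is an eigenvector. -/
theorem onRegister_mulVec_prod (r : Fin k) (V : Matrix (Reg m) (Reg m) ℂ)
    (g : Fin k → Reg m → ℂ) :
    onRegister r V *ᵥ (fun x : Work k m => ∏ s, g s (x s))
      = fun y => ∏ s, Function.update g r (V *ᵥ g r) s (y s) := by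
  ext y
  have hsplit : ∀ (f : Fin k → Reg m → ℂ) (x : Work k m),
      ∏ s, f s (x s) = f r (x r) * ∏ s : {s // s ≠ r}, f s (x s) := by
    intro f x
    rw [← Finset.mul_prod_erase Finset.univ _ (Finset.mem_univ r)]
    congr 1
    exact (Finset.prod_subtype (p := fun s => s ≠ r) (Finset.univ.erase r) (by simp) _)
  rw [hsplit (Function.update g r (V *ᵥ g r)) y]
  simp only [Matrix.mulVec, dotProduct]
  rw [← (Equiv.funSplitAt r (Reg m)).symm.sum_comp, Fintype.sum_prod_type]
  simp only [hsplit g]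
  rw [Function.update_self, Matrix.mulVec, dotProduct, Finset.sum_mul]
  refine Finset.sum_congr rfl fun t _ => ?_
  rw [Finset.sum_eq_single (fun s : {s // s ≠ r} => y s)]
  · have h1 : ∀ s : {s // s ≠ r}, (Equiv.funSplitAt r (Reg m)).symm
        (t, fun s : {s // s ≠ r} => y s) s = y s := by
      intro s
      simp [Equiv.funSplitAt, Equiv.piSplitAt, s.2]
    have h2 : (Equiv.funSplitAt r (Reg m)).symm (t, fun s : {s // s ≠ r} => y s) r = t := by
      simp [Equiv.funSplitAt, Equiv.piSplitAt]
    rw [onRegister, if_pos (fun s hs => (h1 ⟨s, hs⟩).symm), h2, mul_assoc]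
    congr 2
    refine Finset.prod_congr rfl fun s _ => ?_
    rw [h1, Function.update_of_ne s.2]
  · intro w _ hw
    rw [onRegister, if_neg, zero_mul]
    intro h
    refine hw (funext fun s => ?_)
    have := h s s.2
    simpa [Equiv.funSplitAt, Equiv.piSplitAt, s.2] using this.symm
  · simp

/-- Phase estimation on one register for the eigenvalue `z`. -/
def estimateMat (m : ℕ) (z : ℂ) : Matrix (Reg m) (Reg m) ℂ :=
  invQFT m * Matrix.diagonal (fun x => z ^ regValue x) * hadamard m

theorem scalarMat_replicate (z : ℂ) (g : Gate k m) (n : ℕ) :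
    Circuit.scalarMat z (List.replicate n g) = g.scalarMat z ^ n := by
  induction n with
  | zero => simp [Circuit.scalarMat]
  | succ n ih => rw [List.replicate_succ, Circuit.scalarMat, ih, pow_succ]

/-- Exponents of `z` add up along the list; over all qubits they total the binary value of the
register. -/
theorem scalarMat_controlled (z : ℂ) (r : Fin k) (l : List (Fin m)) :
    Circuit.scalarMat z (l.flatMap fun i : Fin m => List.replicate (2 ^ (i : ℕ)) (Gate.ctrl r i))
      = Matrix.diagonal (fun x : Work k m =>
          z ^ (l.map fun i => if x r i = true then 2 ^ (i : ℕ) else 0).sum) := by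
  induction l with
  | nil => simp [Circuit.scalarMat]
  | cons i l ih =>
    rw [List.flatMap_cons, Circuit.scalarMat_append, ih, scalarMat_replicate, Gate.scalarMat,
      Matrix.diagonal_pow, Matrix.diagonal_mul_diagonal]
    congr 1
    ext x
    simp only [Pi.pow_apply, List.map_cons, List.sum_cons, pow_add]
    split_ifs <;> simp [mul_comm]

theorem scalarMat_estimate (z : ℂ) (r : Fin k) :
    Circuit.scalarMat z (estimate (m := m) r) = onRegister r (estimateMat m z) := by
  rw [estimate, Circuit.scalarMat_append, Circuit.scalarMat_append, scalarMat_controlled]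
  have h : (Matrix.diagonal (fun x : Work k m =>
      z ^ ((List.finRange m).map fun i => if x r i = true then 2 ^ (i : ℕ) else 0).sum))
      = onRegister r (Matrix.diagonal (fun x => z ^ regValue x)) := by
    rw [onRegister_diagonal]
    congr 1
  rw [h]
  simp [Circuit.scalarMat, Gate.scalarMat, onRegister_mul, estimateMat, Matrix.mul_assoc]

theorem scalarMat_estimates_mulVec (z : ℂ) (l : List (Fin k)) (hl : l.Nodup)
    (e : Fin k → Reg m → ℂ) :
    Circuit.scalarMat z (l.flatMap (estimate (m := m))) *ᵥ (fun x => ∏ s, e s (x s))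
      = fun x => ∏ s, (if s ∈ l then estimateMat m z *ᵥ e s else e s) (x s) := by
  induction l generalizing e with
  | nil => simp [Circuit.scalarMat]
  | cons r l ih =>
    rw [List.flatMap_cons, Circuit.scalarMat_append, scalarMat_estimate, ← Matrix.mulVec_mulVec,
      onRegister_mulVec_prod, ih hl.of_cons]
    ext x
    refine Finset.prod_congr rfl fun s _ => ?_
    by_cases hs : s = r
    · subst hs
      simp [(List.nodup_cons.mp hl).1]
    · simp [hs]

theorem scalarMat_estimates_isometry (z : ℂ)
    (hz : (estimateMat m z)ᴴ * estimateMat m z = 1) (l : List (Fin k)) :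
    (Circuit.scalarMat z (l.flatMap (estimate (m := m))))ᴴ
      * Circuit.scalarMat z (l.flatMap (estimate (m := m))) = 1 := by
  induction l with
  | nil => simp [Circuit.scalarMat]
  | cons r l ih =>
    rw [List.flatMap_cons, Circuit.scalarMat_append, Matrix.conjTranspose_mul, Matrix.mul_assoc,
      ← Matrix.mul_assoc _ _ (Circuit.scalarMat z (estimate r)), ih, Matrix.one_mul,
      scalarMat_estimate, onRegister_conjTranspose, onRegister_mul, hz, onRegister_one]

end OnRegister

/-! ### Phase estimation on one register -/

section Register

variable {m : ℕ}

/-- The integers `0, …, 2^m - 1` as contents of a register. -/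
def regEquiv (m : ℕ) : Reg m ≃ Fin (2 ^ m) :=
  (Equiv.arrowCongr (Equiv.refl (Fin m)) finTwoEquiv.symm).trans finFunctionFinEquiv

theorem regEquiv_val (x : Reg m) : (regEquiv m x : ℕ) = regValue x := by
  rw [regEquiv, Equiv.trans_apply, finFunctionFinEquiv_apply_val, regValue]
  refine Finset.sum_congr rfl fun i _ => ?_
  simp only [Equiv.arrowCongr_apply, Function.comp]
  cases h : x i <;> simp [h, finTwoEquiv]

theorem regValue_lt (x : Reg m) : regValue x < 2 ^ m := by
  rw [← regEquiv_val]; exact (regEquiv m x).2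

theorem regValue_injective : Function.Injective (regValue (m := m)) := by
  intro x y h
  rw [← regEquiv_val, ← regEquiv_val] at h
  exact (regEquiv m).injective (Fin.ext h)

theorem sum_regValue {M : Type*} [AddCommMonoid M] (f : ℕ → M) :
    ∑ x : Reg m, f (regValue x) = ∑ j ∈ Finset.range (2 ^ m), f j := by
  rw [← Fin.sum_univ_eq_sum_range, ← (regEquiv m).sum_comp]
  simp only [regEquiv_val]

theorem inv_sqrt_mul_self (x : ℝ) (hx : 0 ≤ x) :
    ((Real.sqrt x : ℂ))⁻¹ * ((Real.sqrt x : ℂ))⁻¹ = (x : ℂ)⁻¹ := by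
  rw [← mul_inv, ← Complex.ofReal_mul, Real.mul_self_sqrt hx]

/-- The entries are products over qubits, so the sum over basis states factors into sums over single
bits. -/
theorem hadamard_isometry (m : ℕ) : (hadamard m)ᴴ * hadamard m = 1 := by
  ext y x
  rw [Matrix.mul_apply]
  simp only [Matrix.conjTranspose_apply, hadamard, star_prod, ← Finset.prod_mul_distrib]
  have h := Finset.prod_univ_sum (fun _ : Fin m => (Finset.univ : Finset Bool))
    (fun i b => star ((if b = true ∧ y i = true then (-1 : ℂ) else 1) / (Real.sqrt 2 : ℂ))
      * ((if b = true ∧ x i = true then (-1 : ℂ) else 1) / (Real.sqrt 2 : ℂ)))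
  rw [Fintype.piFinset_univ] at h
  rw [← h]
  have h2 : ((Real.sqrt 2 : ℂ))⁻¹ * ((Real.sqrt 2 : ℂ))⁻¹ = 2⁻¹ := by
    simpa using inv_sqrt_mul_self 2 (by norm_num)
  have hb : ∀ i : Fin m, (∑ b : Bool,
      star ((if b = true ∧ y i = true then (-1 : ℂ) else 1) / (Real.sqrt 2 : ℂ))
      * ((if b = true ∧ x i = true then (-1 : ℂ) else 1) / (Real.sqrt 2 : ℂ)))
      = if y i = x i then 1 else 0 := by
    intro i
    cases y i <;> cases x i <;> (simp [div_eq_mul_inv, h2]; try norm_num)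
  rw [Finset.prod_congr rfl fun i _ => hb i, Finset.prod_ite_zero, Matrix.one_apply]
  simp [funext_iff]

theorem geom_sum_eq_zero_of_pow_eq_one {q : ℂ} {n : ℕ} (h1 : q ≠ 1) (hn : q ^ n = 1) :
    ∑ j ∈ Finset.range n, q ^ j = 0 := by
  rw [geom_sum_eq h1, hn, sub_self, zero_div]

theorem exp_root_pow (t : ℤ) {N : ℕ} (hN : N ≠ 0) :
    Complex.exp (2 * Real.pi * Complex.I * t / N) ^ N = 1 := by
  rw [← Complex.exp_nat_mul, Complex.exp_eq_one_iff]
  refine ⟨t, ?_⟩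
  have : (N : ℂ) ≠ 0 := Nat.cast_ne_zero.mpr hN
  field_simp

theorem exp_root_ne_one (t : ℤ) {N : ℕ} (ht : t ≠ 0) (hlt : |t| < N) :
    Complex.exp (2 * Real.pi * Complex.I * t / N) ≠ 1 := by
  rw [Ne, Complex.exp_eq_one_iff]
  rintro ⟨n, hn⟩
  have hN : (N : ℂ) ≠ 0 := by
    rintro h0
    have : N = 0 := by exact_mod_cast h0
    subst this
    have := abs_nonneg t
    simp at hlt
    omega
  have hpi : (2 * Real.pi * Complex.I : ℂ) ≠ 0 := Complex.two_pi_I_ne_zero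
  have h2 : (t : ℂ) = n * N := by
    field_simp at hn
    rw [hn, mul_comm]
  have h3 : t = n * N := by exact_mod_cast h2
  have h4 : (N : ℤ) ∣ t := ⟨n, by rw [h3, mul_comm]⟩
  exact ht (Int.eq_zero_of_abs_lt_dvd h4 hlt)

theorem sum_exp_root (t : ℤ) {N : ℕ} (hlt : |t| < N) :
    ∑ j ∈ Finset.range N, Complex.exp (2 * Real.pi * Complex.I * t / N) ^ j
      = if t = 0 then (N : ℂ) else 0 := by
  split_ifs with h
  · simp [h]
  · refine geom_sum_eq_zero_of_pow_eq_one (exp_root_ne_one t h hlt) (exp_root_pow t ?_)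
    rintro rfl
    have := abs_nonneg t
    simp at hlt
    omega

theorem invQFT_isometry (m : ℕ) : (invQFT m)ᴴ * invQFT m = 1 := by
  ext y x
  rw [Matrix.mul_apply]
  have hs : ((Real.sqrt (2 ^ m) : ℂ))⁻¹ * ((Real.sqrt (2 ^ m) : ℂ))⁻¹ = ((2 ^ m : ℕ) : ℂ)⁻¹ := by
    rw [inv_sqrt_mul_self _ (by positivity)]; push_cast; rfl
  have hterm : ∀ w : Reg m, (invQFT m)ᴴ y w * invQFT m w x
      = (Complex.exp (2 * Real.pi * Complex.I * ((regValue y : ℤ) - (regValue x : ℤ) : ℤ)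
          / (2 ^ m : ℕ))) ^ regValue w * ((2 ^ m : ℕ) : ℂ)⁻¹ := by
    intro w
    rw [Matrix.conjTranspose_apply, invQFT, invQFT, ← hs, ← Complex.exp_nat_mul]
    simp only [star_div₀, Complex.star_def, ← Complex.exp_conj, Complex.conj_ofReal]
    rw [div_mul_div_comm, ← Complex.exp_add, div_eq_mul_inv, mul_inv]
    congr 2
    simp only [map_neg, map_div₀, map_mul, map_pow, Complex.conj_I, Complex.conj_ofReal,
      map_natCast, map_ofNat]
    push_cast
    ring
  have hlt : |(regValue y : ℤ) - (regValue x : ℤ)| < (2 ^ m : ℕ) := by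
    have h1 := regValue_lt y
    have h2 := regValue_lt x
    rw [abs_lt]
    omega
  rw [Finset.sum_congr rfl fun w _ => hterm w, ← Finset.sum_mul,
    sum_regValue (fun j => (Complex.exp (2 * Real.pi * Complex.I *
      ((regValue y : ℤ) - (regValue x : ℤ) : ℤ) / (2 ^ m : ℕ))) ^ j), sum_exp_root _ hlt,
    Matrix.one_apply]
  by_cases h : y = x
  · subst h; simp
  · rw [if_neg, if_neg h, zero_mul]
    intro h0
    exact h (regValue_injective (by omega))

theorem estimateMat_isometry {z : ℂ} (hz : ‖z‖ = 1) :
    (estimateMat m z)ᴴ * estimateMat m z = 1 := by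
  have hd : (Matrix.diagonal fun x : Reg m => z ^ regValue x)ᴴ
      * (Matrix.diagonal fun x : Reg m => z ^ regValue x) = 1 := by
    rw [Matrix.diagonal_conjTranspose, Matrix.diagonal_mul_diagonal, ← Matrix.diagonal_one]
    congr 1
    ext x
    rw [Pi.star_apply, Complex.star_def, Complex.conj_mul', norm_pow, hz]
    simp
  rw [estimateMat, Matrix.conjTranspose_mul, Matrix.conjTranspose_mul, Matrix.mul_assoc,
    Matrix.mul_assoc, ← Matrix.mul_assoc (invQFT m)ᴴ, ← Matrix.mul_assoc (invQFT m)ᴴ,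
    invQFT_isometry, Matrix.one_mul, ← Matrix.mul_assoc _ _ (hadamard m), hd, Matrix.one_mul,
    hadamard_isometry]

/-- The amplitude of the outcome `y` of phase estimation for the eigenvalue `z`. -/
def amplitude (m : ℕ) (z : ℂ) : Reg m → ℂ :=
  estimateMat m z *ᵥ fun x => if x = (fun _ => false) then 1 else 0

theorem hadamard_zero (x : Reg m) :
    hadamard m x (fun _ => false) = ((Real.sqrt (2 ^ m) : ℂ))⁻¹ := by
  have h : Real.sqrt (2 ^ m) = Real.sqrt 2 ^ m := by
    rw [Real.sqrt_eq_iff_mul_self_eq (by positivity) (by positivity), ← mul_pow,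
      Real.mul_self_sqrt (by norm_num)]
  simp [hadamard, h]

theorem amplitude_eq (m : ℕ) (z : ℂ) (y : Reg m) :
    amplitude m z y = (∑ j ∈ Finset.range (2 ^ m),
      (z * Complex.exp (-(2 * Real.pi * regValue y / 2 ^ m : ℝ) * Complex.I)) ^ j) / 2 ^ m := by
  have hs : ((Real.sqrt (2 ^ m) : ℂ))⁻¹ * ((Real.sqrt (2 ^ m) : ℂ))⁻¹ = ((2 : ℂ) ^ m)⁻¹ := by
    rw [inv_sqrt_mul_self _ (by positivity)]; push_cast; rfl
  rw [amplitude, estimateMat, ← Matrix.mulVec_mulVec, ← Matrix.mulVec_mulVec]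
  have h0 : (hadamard m *ᵥ fun x => if x = (fun _ => false) then (1 : ℂ) else 0)
      = fun _ => ((Real.sqrt (2 ^ m) : ℂ))⁻¹ := by
    ext x
    simp [Matrix.mulVec, dotProduct, hadamard_zero]
  rw [h0, ← sum_regValue, Finset.sum_div, Matrix.mulVec, dotProduct]
  refine Finset.sum_congr rfl fun x _ => ?_
  have he : (-(2 * Real.pi * Complex.I * (regValue x : ℂ) * (regValue y : ℂ) / 2 ^ m) : ℂ)
      = (regValue x : ℂ) * (-((2 * Real.pi * regValue y / 2 ^ m : ℝ) : ℂ) * Complex.I) := by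
    push_cast; ring
  rw [Matrix.mulVec_diagonal, invQFT, mul_pow, ← Complex.exp_nat_mul, he, div_eq_mul_inv,
    div_eq_mul_inv _ ((2 : ℂ) ^ m), ← hs]
  ring

theorem sum_norm_sq_mulVec {n : Type*} [Fintype n] [DecidableEq n] {A : Matrix n n ℂ}
    (hA : Aᴴ * A = 1) (v : n → ℂ) : ∑ y, ‖(A *ᵥ v) y‖ ^ 2 = ∑ y, ‖v y‖ ^ 2 := by
  have h : ∀ w : n → ℂ, ((∑ y, ‖w y‖ ^ 2 : ℝ) : ℂ) = star w ⬝ᵥ w := by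
    intro w
    rw [dotProduct]
    push_cast
    exact Finset.sum_congr rfl fun y _ => (Complex.conj_mul' _).symm
  have h2 : ((∑ y, ‖(A *ᵥ v) y‖ ^ 2 : ℝ) : ℂ) = ((∑ y, ‖v y‖ ^ 2 : ℝ) : ℂ) := by
    rw [h, h, Matrix.star_mulVec, Matrix.dotProduct_mulVec, Matrix.vecMul_vecMul, hA,
      Matrix.vecMul_one]
  exact_mod_cast h2

theorem sum_norm_sq_amplitude {z : ℂ} (hz : ‖z‖ = 1) :
    ∑ y, ‖amplitude m z y‖ ^ 2 = 1 := by
  rw [amplitude, sum_norm_sq_mulVec (estimateMat_isometry hz)]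
  rw [Finset.sum_eq_single (fun _ => false)]
  · simp
  · intro b _ hb; simp [hb]
  · simp

end Register

/-! ### Tail bounds for phase estimation -/

section Tail

variable {m : ℕ}

/-- Jordan's inequality, applied to `π - t` beyond `π / 2`. The slope `2 / (3π)` is the largest that
this argument yields up to `3π / 4`. -/
theorem mul_le_sin_of_le_three_quarters {t : ℝ} (h0 : 0 ≤ t) (h1 : t ≤ 3 * Real.pi / 4) :
    2 / (3 * Real.pi) * t ≤ Real.sin t := by
  have hpi := Real.pi_pos
  rcases le_total t (Real.pi / 2) with h | h
  · refine le_trans ?_ (Real.mul_le_sin h0 h)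
    gcongr
    linarith
  · rw [← Real.sin_pi_sub]
    refine le_trans ?_ (Real.mul_le_sin (by linarith) (by linarith))
    rw [div_mul_eq_mul_div, div_mul_eq_mul_div, div_le_div_iff₀ (by positivity) hpi]
    nlinarith

/-- The numerator of the closed form is at most `2`, and the denominator is `2 |sin (θ / 2)|`. The
range reaches beyond `π` because a wrong sign reading can be that far from the true phase; it must
stay away from `2π`, where the denominator vanishes. -/
theorem norm_geom_sum_exp_le {θ : ℝ} (h0 : θ ≠ 0) (h1 : |θ| ≤ 3 * Real.pi / 2) (N : ℕ) :
    ‖∑ j ∈ Finset.range N, Complex.exp (θ * Complex.I) ^ j‖ ≤ 3 * Real.pi / |θ| := by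
  have hpi := Real.pi_pos
  have hθ : 0 < |θ| := abs_pos.mpr h0
  have hlow : 2 * |θ| / (3 * Real.pi) ≤ ‖Complex.exp (θ * Complex.I) - 1‖ := by
    rw [mul_comm (θ : ℂ), Complex.norm_exp_I_mul_ofReal_sub_one, norm_mul, Real.norm_eq_abs,
      Real.norm_eq_abs, abs_two]
    have h2 := mul_le_sin_of_le_three_quarters (t := |θ| / 2) (by positivity) (by linarith)
    have h3 : Real.sin (|θ| / 2) ≤ |Real.sin (θ / 2)| := by
      rcases abs_cases θ with ⟨h, -⟩ | ⟨h, -⟩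
      · rw [h]; exact le_abs_self _
      · rw [h, neg_div, Real.sin_neg]; exact neg_le_abs _
    calc 2 * |θ| / (3 * Real.pi) = 2 * (2 / (3 * Real.pi) * (|θ| / 2)) := by ring
      _ ≤ 2 * |Real.sin (θ / 2)| := by linarith
  have hpos : 0 < 2 * |θ| / (3 * Real.pi) := by positivity
  have hne : Complex.exp (θ * Complex.I) ≠ 1 := by
    intro h
    rw [h, sub_self, norm_zero] at hlow
    linarith
  rw [geom_sum_eq hne, norm_div]
  have hup : ‖Complex.exp (θ * Complex.I) ^ N - 1‖ ≤ 2 := by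
    refine (norm_sub_le _ _).trans ?_
    rw [norm_pow, Complex.norm_exp_ofReal_mul_I, one_pow, norm_one]
    norm_num
  calc _ ≤ 2 / (2 * |θ| / (3 * Real.pi)) := by gcongr
    _ = 3 * Real.pi / |θ| := by field_simp

theorem exp_neg_regValue (y : Reg m) :
    Complex.exp (-(2 * Real.pi * regValue y / 2 ^ m : ℝ) * Complex.I)
      = Complex.exp (-(estimatedPhase y : ℂ) * Complex.I) := by
  rw [estimatedPhase]
  split_ifs
  · rfl
  · rw [Complex.exp_eq_exp_iff_exists_int]
    refine ⟨-1, ?_⟩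
    push_cast
    ring

theorem norm_sq_amplitude_le {z : ℂ} (hz : ‖z‖ = 1) (y : Reg m)
    (h0 : z.arg - estimatedPhase y ≠ 0) (h1 : |z.arg - estimatedPhase y| ≤ 3 * Real.pi / 2) :
    ‖amplitude m z y‖ ^ 2 ≤ (3 * Real.pi / (2 ^ m * |z.arg - estimatedPhase y|)) ^ 2 := by
  have hexp : z * Complex.exp (-(2 * Real.pi * regValue y / 2 ^ m : ℝ) * Complex.I)
      = Complex.exp ((z.arg - estimatedPhase y : ℝ) * Complex.I) := by
    have h := Complex.norm_mul_exp_arg_mul_I z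
    rw [hz, Complex.ofReal_one, one_mul] at h
    rw [exp_neg_regValue]
    nth_rw 1 [← h]
    rw [← Complex.exp_add]
    congr 1
    push_cast
    ring
  rw [amplitude_eq, hexp, norm_div, norm_pow, Complex.norm_ofNat]
  refine pow_le_pow_left₀ (by positivity) ?_ 2
  calc _ ≤ 3 * Real.pi / |z.arg - estimatedPhase y| / 2 ^ m := by
        gcongr
        exact norm_geom_sum_exp_le h0 h1 _
    _ = _ := by rw [div_div, mul_comm (2 ^ m : ℝ)]

/-- Each term is at most `1 / (x + j - 1) - 1 / (x + j)`, and these differences telescope. -/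
theorem sum_one_div_add_sq_le {x : ℝ} (hx : 1 < x) (M : ℕ) :
    ∑ j ∈ Finset.range M, 1 / (x + j) ^ 2 ≤ 1 / (x - 1) := by
  have h : ∑ j ∈ Finset.range M, 1 / (x + j) ^ 2 ≤ 1 / (x - 1) - 1 / (x + M - 1) := by
    induction M with
    | zero => simp
    | succ M ih =>
      rw [Finset.sum_range_succ]
      have hM : (0 : ℝ) ≤ M := Nat.cast_nonneg M
      have h1 : 0 < x + M - 1 := by linarith
      have h2 : 0 < x + M := by linarith
      have key : 1 / (x + M) ^ 2 ≤ 1 / (x + M - 1) - 1 / (x + M) := by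
        rw [div_sub_div _ _ h1.ne' h2.ne', div_le_div_iff₀ (by positivity) (by positivity)]
        nlinarith
      push_cast
      rw [show x + ((M : ℝ) + 1) - 1 = x + M by ring]
      linarith
  have : 0 < 1 / (x + M - 1) := by
    have hM : (0 : ℝ) ≤ M := Nat.cast_nonneg M
    exact one_div_pos.mpr (by linarith)
  linarith

/-- The register content `y` gives the wrong sign for the phase of `z`. -/
def Misread (z : ℂ) (y : Reg m) : Prop := 0 ≤ z.arg ↔ estimatedPhase y < 0

theorem estimatedPhase_neg_iff (y : Reg m) : estimatedPhase y < 0 ↔ 2 ^ m < 2 * regValue y := by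
  have hpi := Real.pi_pos
  rw [estimatedPhase]
  split_ifs with h
  · have : 0 ≤ 2 * Real.pi * regValue y / 2 ^ m := by positivity
    constructor
    · intro h'; linarith
    · intro h'; omega
  · refine ⟨fun _ => not_le.mp h, fun _ => ?_⟩
    have hlt : (regValue y : ℝ) < 2 ^ m := by exact_mod_cast regValue_lt y
    rw [sub_neg, div_lt_iff₀ (by positivity)]
    gcongr

-- A reading of the wrong sign lies on the other side of `0`, so its distance from the true phase is
-- the sum of the two absolute values. The bound `π / 2` on the true phase keeps this distance
-- within `3π / 2`. Squared amplitudes then decay like an inverse square along distinct grid points,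
-- starting at distance `|arg z|`.
open Classical in
theorem sum_misread_le {z : ℂ} (hz : ‖z‖ = 1) (harg : |z.arg| ≤ Real.pi / 2)
    (hprec : 74 * Real.pi ≤ 2 ^ m * |z.arg|) :
    ∑ y : Reg m with Misread z y, ‖amplitude m z y‖ ^ 2 ≤ 1 / 16 := by
  have hpi := Real.pi_pos
  have hN : (0 : ℝ) < 2 ^ m := by positivity
  have harg0 : 0 < |z.arg| := by
    by_contra h
    nlinarith
  set x : ℝ := 2 ^ m * |z.arg| / (2 * Real.pi) with hx
  have hx37 : 37 ≤ x := by
    rw [hx, le_div_iff₀ (by positivity)]; linarith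
  -- `2 π j y / 2^m` is the absolute value of the estimated phase
  set j : Reg m → ℕ := fun y => if 0 ≤ z.arg then 2 ^ m - regValue y else regValue y with hj
  have hjinj : Function.Injective j := by
    intro y y' h
    have h1 := regValue_lt y
    have h2 := regValue_lt y'
    simp only [hj] at h
    split_ifs at h
    · exact regValue_injective (by omega)
    · exact regValue_injective h
  have hjle : ∀ y, j y ≤ 2 ^ m := by
    intro y
    have h1 := regValue_lt y
    simp only [hj]
    split_ifs <;> omega
  have hdist : ∀ y, Misread z y →
      |z.arg - estimatedPhase y| = |z.arg| + 2 * Real.pi * j y / 2 ^ m ∧ 2 * j y ≤ 2 ^ m := by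
    intro y hy
    have h1 := regValue_lt y
    rw [Misread, estimatedPhase_neg_iff] at hy
    by_cases hs : 0 ≤ z.arg
    · have h2 := hy.mp hs
      have hjy : j y = 2 ^ m - regValue y := by simp [hj, hs]
      rw [estimatedPhase, if_neg (not_le.mpr h2), hjy, Nat.cast_sub h1.le]
      refine ⟨?_, by omega⟩
      have h3 : (regValue y : ℝ) ≤ 2 ^ m := by exact_mod_cast h1.le
      have h4 : 2 * Real.pi * regValue y / 2 ^ m ≤ 2 * Real.pi := by
        rw [div_le_iff₀ hN]; gcongr
      rw [abs_of_nonneg hs, abs_of_nonneg (by linarith)]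
      push_cast
      field_simp
      ring
    · have h2 := not_lt.mp (fun h => hs (hy.mpr h))
      have hjy : j y = regValue y := by simp [hj, hs]
      rw [estimatedPhase, if_pos h2, hjy]
      refine ⟨?_, h2⟩
      have h3 : 0 ≤ 2 * Real.pi * regValue y / 2 ^ m := by positivity
      push Not at hs
      rw [abs_of_neg hs, abs_of_nonpos (by linarith)]
      ring
  have hterm : ∀ y ∈ Finset.univ.filter (Misread z),
      ‖amplitude m z y‖ ^ 2 ≤ 9 / 4 * (1 / (x + j y) ^ 2) := by
    intro y hy
    obtain ⟨hd, hjy⟩ := hdist y (by simpa using hy)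
    have hjy' : 2 * (j y : ℝ) ≤ 2 ^ m := by exact_mod_cast hjy
    have hj0 : 0 ≤ 2 * Real.pi * j y / 2 ^ m := by positivity
    have hjpi : 2 * Real.pi * j y / 2 ^ m ≤ Real.pi := by
      rw [div_le_iff₀ hN]; nlinarith
    -- In grid units `2π / 2^m` the distance is `x + j y`, so the squared amplitude bound is `(3π /
    -- (2π (x + j y)))²`; hence the factor `9 / 4`.
    refine (norm_sq_amplitude_le hz y (abs_pos.mp (by rw [hd]; linarith))
      (by rw [hd]; linarith)).trans (le_of_eq ?_)
    have hxj : 2 ^ m * (|z.arg| + 2 * Real.pi * j y / 2 ^ m) = 2 * Real.pi * (x + j y) := by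
      rw [hx]; field_simp
    have hpos : 0 < x + j y := by positivity
    rw [hd, hxj]
    field_simp
    norm_num
  refine (Finset.sum_le_sum hterm).trans ?_
  rw [← Finset.mul_sum]
  have h1 : ∑ y ∈ Finset.univ.filter (Misread z), 1 / (x + j y) ^ 2
      ≤ ∑ i ∈ Finset.range (2 ^ m + 1), 1 / (x + i) ^ 2 := by
    rw [← Finset.sum_image (f := fun i : ℕ => 1 / (x + i) ^ 2) hjinj.injOn]
    refine Finset.sum_le_sum_of_subset_of_nonneg ?_ fun i _ _ => by positivity
    intro i hi
    obtain ⟨y, -, rfl⟩ := Finset.mem_image.mp hi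
    exact Finset.mem_range.mpr (Nat.lt_succ_of_le (hjle y))
  have h2 := sum_one_div_add_sq_le (x := x) (by linarith) (2 ^ m + 1)
  -- The constant `74π` means `x ≥ 37`, chosen so that `9/4 · 1/36 = 1/16`.
  have h3 : 1 / (x - 1) ≤ 1 / 36 := one_div_le_one_div_of_le (by norm_num) (by linarith)
  linarith

/-- The phase `0` lies on the grid, so every nonzero outcome has as amplitude a vanishing sum of
roots of unity. The eigenvalue `1` needs this separately, since no precision resolves the phase `0`.
-/
theorem amplitude_one_eq_zero {y : Reg m} (hy : Misread 1 y) : amplitude m 1 y = 0 := by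
  have hneg : 2 ^ m < 2 * regValue y := by
    rw [← estimatedPhase_neg_iff]; exact hy.mp (by simp)
  have hlt := regValue_lt y
  rw [amplitude_eq]
  have h := sum_exp_root (-(regValue y : ℤ)) (N := 2 ^ m) (by
    rw [abs_neg, Nat.abs_cast]; exact_mod_cast hlt)
  rw [if_neg (by omega)] at h
  have he : (1 : ℂ) * Complex.exp (-(2 * Real.pi * regValue y / 2 ^ m : ℝ) * Complex.I)
      = Complex.exp (2 * Real.pi * Complex.I * (-(regValue y : ℤ) : ℤ) / (2 ^ m : ℕ)) := by
    rw [one_mul]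
    congr 1
    push_cast
    ring
  rw [he, h, zero_div]

/-! ### Amplification by majority -/

open Classical in
/-- A product distribution puts mass at most `2⁻ᵏ` on the points at least half of whose
coordinates lie in a set of mass at most `1 / 16`. -/
theorem sum_prod_majority_le {α : Type*} [Fintype α] {p : α → ℝ} (hp : ∀ y, 0 ≤ p y)
    (hsum : ∑ y, p y = 1) {B : α → Prop} (hB : ∑ y with B y, p y ≤ 1 / 16) (k : ℕ) :
    ∑ x : Fin k → α with k ≤ 2 * (Finset.univ.filter fun r => B (x r)).card, ∏ r, p (x r)
      ≤ (1 / 2) ^ k := by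
  have hpos : ∀ x : Fin k → α, 0 ≤ ∏ r, p (x r) := fun x => Finset.prod_nonneg fun r _ => hp _
  -- Chernoff's method: each coordinate in `B` gets weight `16`. The mean weight per coordinate is
  -- at most `1 + 15/16 ≤ 2`, while the points counted have weight at least `4^k`; the quotient is
  -- `2⁻ᵏ`.
  have hweight : ∀ x : Fin k → α, ∏ r, (p (x r) * if B (x r) then 16 else 1)
      = (∏ r, p (x r)) * 16 ^ (Finset.univ.filter fun r => B (x r)).card := by
    intro x
    rw [Finset.prod_mul_distrib, Finset.prod_ite]
    simp
  have htotal : ∑ x : Fin k → α, ∏ r, (p (x r) * if B (x r) then 16 else 1)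
      = (∑ y, p y * if B y then 16 else 1) ^ k := by
    have h := Finset.prod_univ_sum (fun _ : Fin k => (Finset.univ : Finset α))
      (fun _ y => p y * if B y then 16 else 1)
    rw [Fintype.piFinset_univ] at h
    rw [← h]
    simp
  have hone : ∑ y, p y * (if B y then 16 else 1) ≤ 2 := by
    have h1 : ∀ y, p y * (if B y then 16 else 1) = p y + 15 * (if B y then p y else 0) := by
      intro y; split_ifs <;> ring
    rw [Finset.sum_congr rfl fun y _ => h1 y, Finset.sum_add_distrib, hsum, ← Finset.mul_sum,
      ← Finset.sum_filter]
    linarith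
  have hnn : 0 ≤ ∑ y, p y * (if B y then 16 else 1) :=
    Finset.sum_nonneg fun y _ => mul_nonneg (hp y) (by split_ifs <;> norm_num)
  calc _ ≤ ∑ x : Fin k → α with k ≤ 2 * (Finset.univ.filter fun r => B (x r)).card,
        (∏ r, (p (x r) * if B (x r) then 16 else 1)) * (1 / 4) ^ k := by
        refine Finset.sum_le_sum fun x hx => ?_
        have hx' := (Finset.mem_filter.mp hx).2
        rw [hweight, mul_assoc]
        refine le_mul_of_one_le_right (hpos x) ?_
        have h4 : (4 : ℝ) ^ k ≤ 16 ^ (Finset.univ.filter fun r => B (x r)).card := by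
          rw [show (16 : ℝ) = 4 ^ 2 by norm_num, ← pow_mul]
          exact pow_le_pow_right₀ (by norm_num) hx'
        calc (1 : ℝ) = 4 ^ k * (1 / 4) ^ k := by rw [← mul_pow]; norm_num
          _ ≤ _ := by gcongr
    _ ≤ ∑ x : Fin k → α, (∏ r, (p (x r) * if B (x r) then 16 else 1)) * (1 / 4) ^ k := by
        refine Finset.sum_le_sum_of_subset_of_nonneg (Finset.filter_subset _ _) fun x _ _ => ?_
        rw [hweight]
        exact mul_nonneg (mul_nonneg (hpos x) (by positivity)) (by positivity)
    _ = (∑ y, p y * if B y then 16 else 1) ^ k * (1 / 4) ^ k := by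
        rw [← Finset.sum_mul, htotal]
    _ ≤ 2 ^ k * (1 / 4) ^ k := by gcongr
    _ = (1 / 2) ^ k := by rw [← mul_pow]; norm_num

end Tail

/-! ### The rotation procedure on an eigenvector -/

section Rotate

variable {k m : ℕ}

/-- The initial state of the workspace. -/
def zeroState (k m : ℕ) : Work k m → ℂ := fun x => if x = (fun _ _ => false) then 1 else 0

/-- The sign by which the `U`-rotation multiplies an eigenvector for `z`. -/
def phaseSign (z : ℂ) : ℂ := if 0 ≤ z.arg then 1 else -1

/-- The deviation of the rotation procedure on an eigenvector for `z` from the `U`-rotation. -/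
def rotationDefect (k m : ℕ) (z : ℂ) : Work k m → ℂ :=
  Circuit.scalarMat z (rotateCircuit k m) *ᵥ zeroState k m - phaseSign z • zeroState k m

theorem zeroState_eq_prod :
    zeroState k m = fun x => ∏ s, (if x s = (fun _ => false) then (1 : ℂ) else 0) := by
  ext x
  rw [zeroState, Finset.prod_ite_zero]
  simp [funext_iff]

theorem estimates_mulVec_zeroState (z : ℂ) :
    Circuit.scalarMat z ((List.finRange k).flatMap (estimate (m := m))) *ᵥ zeroState k m
      = fun x => ∏ s, amplitude m z (x s) := by
  rw [zeroState_eq_prod, scalarMat_estimates_mulVec z _ (List.nodup_finRange k)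
    (fun _ x => if x = (fun _ => false) then 1 else 0)]
  simp [amplitude]

-- Ties are the reason for the non-strict inequality: an even split causes no flip, which is an
-- error when the phase is negative.
open Classical in
theorem majorityFlip_ne_phaseSign {z : ℂ} {x : Work k m}
    (h : (if k < 2 * (Finset.univ.filter (fun r : Fin k => estimatedPhase (x r) < 0)).card
      then -1 else 1) ≠ phaseSign z) :
    k ≤ 2 * (Finset.univ.filter fun r => Misread z (x r)).card := by
  by_cases hz : 0 ≤ z.arg
  · have hM : ∀ r, Misread z (x r) ↔ estimatedPhase (x r) < 0 := fun r => by simp [Misread, hz]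
    simp only [hM]
    by_contra hlt
    exact h (by rw [if_neg (by omega), phaseSign, if_pos hz])
  · have hM : ∀ r, Misread z (x r) ↔ ¬ estimatedPhase (x r) < 0 := fun r => by simp [Misread, hz]
    simp only [hM]
    have hcard := Finset.card_filter_add_card_filter_not (s := (Finset.univ : Finset (Fin k)))
      (fun r => estimatedPhase (x r) < 0)
    rw [Finset.card_univ, Fintype.card_fin] at hcard
    by_contra hlt
    exact h (by rw [if_pos (by omega), phaseSign, if_neg hz])

-- `E` is a square isometry, so `Eᴴ` preserves norms and the defect can be measured before the phase
-- estimations are undone. There it is diagonal, with entries `0` or `±2`, the latter only where at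
-- least half of the readings are wrong.
open Classical in
theorem sum_norm_sq_rotationDefect_le {z : ℂ} (hz : ‖z‖ = 1) :
    ∑ x, ‖rotationDefect k m z x‖ ^ 2 ≤
      4 * ∑ x : Work k m with k ≤ 2 * (Finset.univ.filter fun r => Misread z (x r)).card,
        ∏ r, ‖amplitude m z (x r)‖ ^ 2 := by
  set E := Circuit.scalarMat z ((List.finRange k).flatMap (estimate (m := m))) with hE
  have hiso : Eᴴ * E = 1 := scalarMat_estimates_isometry z (estimateMat_isometry hz) _
  have hdef : rotationDefect k m z = Eᴴ *ᵥ (majorityFlip k m *ᵥ (E *ᵥ zeroState k m)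
      - phaseSign z • (E *ᵥ zeroState k m)) := by
    rw [Matrix.mulVec_sub, Matrix.mulVec_smul, Matrix.mulVec_mulVec _ Eᴴ E, hiso,
      Matrix.one_mulVec, rotationDefect, rotateCircuit]
    simp only [Circuit.scalarMat_append, Circuit.scalarMat_undo, Circuit.scalarMat,
      Gate.scalarMat, Matrix.one_mul, ← Matrix.mulVec_mulVec, ← hE]
  rw [hdef, sum_norm_sq_mulVec (by rw [Matrix.conjTranspose_conjTranspose]
                                   exact mul_eq_one_comm.mp hiso),
    hE, estimates_mulVec_zeroState, Finset.mul_sum, Finset.sum_filter]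
  refine Finset.sum_le_sum fun x _ => ?_
  rw [Pi.sub_apply, majorityFlip, Matrix.mulVec_diagonal, Pi.smul_apply, smul_eq_mul, ← sub_mul,
    norm_mul, mul_pow, norm_prod, Finset.prod_pow]
  split_ifs with h1 h2 h2
  · gcongr
    unfold phaseSign; split_ifs <;> norm_num
  · rw [show ((-1 : ℂ) - phaseSign z) = 0 by
      by_contra hne
      exact h2 (majorityFlip_ne_phaseSign (by rw [if_pos h1]; exact sub_ne_zero.mp hne))]
    simp
  · gcongr
    unfold phaseSign; split_ifs <;> norm_num
  · rw [show ((1 : ℂ) - phaseSign z) = 0 by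
      by_contra hne
      exact h2 (majorityFlip_ne_phaseSign (by rw [if_neg h1]; exact sub_ne_zero.mp hne))]
    simp

theorem sum_norm_sq_rotationDefect_le_four {z : ℂ} (hz : ‖z‖ = 1) :
    ∑ x, ‖rotationDefect k m z x‖ ^ 2 ≤ 4 := by
  classical
  refine (sum_norm_sq_rotationDefect_le hz).trans ?_
  have h := Finset.prod_univ_sum (fun _ : Fin k => (Finset.univ : Finset (Reg m)))
    (fun _ y => ‖amplitude m z y‖ ^ 2)
  rw [Fintype.piFinset_univ] at h
  have h1 : ∑ x : Work k m, ∏ r, ‖amplitude m z (x r)‖ ^ 2 = 1 := by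
    rw [← h]; simp [sum_norm_sq_amplitude hz]
  have h2 : ∑ x : Work k m with k ≤ 2 * (Finset.univ.filter fun r => Misread z (x r)).card,
      ∏ r, ‖amplitude m z (x r)‖ ^ 2 ≤ 1 := by
    rw [← h1]
    exact Finset.sum_le_sum_of_subset_of_nonneg (Finset.filter_subset _ _)
      fun x _ _ => Finset.prod_nonneg fun r _ => by positivity
  linarith

theorem sum_norm_sq_rotationDefect_le_pow {z : ℂ} (hz : ‖z‖ = 1) (harg : |z.arg| ≤ Real.pi / 2)
    (hprec : 74 * Real.pi ≤ 2 ^ m * |z.arg|) :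
    ∑ x, ‖rotationDefect k m z x‖ ^ 2 ≤ 4 * (1 / 2) ^ k := by
  classical
  refine (sum_norm_sq_rotationDefect_le hz).trans ?_
  gcongr
  exact sum_prod_majority_le (fun y => by positivity) (sum_norm_sq_amplitude hz)
    (sum_misread_le hz harg hprec) k

theorem sum_norm_sq_rotationDefect_one_le :
    ∑ x, ‖rotationDefect k m 1 x‖ ^ 2 ≤ 4 * (1 / 2) ^ k := by
  classical
  -- With no registers, "at least half are misread" holds vacuously, and the trivial bound `4` is
  -- the claim. With `k > 0` it forces a misread register, whose amplitude is zero.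
  rcases Nat.eq_zero_or_pos k with rfl | hk
  · simpa using sum_norm_sq_rotationDefect_le_four (k := 0) (m := m) norm_one
  refine (sum_norm_sq_rotationDefect_le norm_one).trans ?_
  rw [Finset.sum_eq_zero, mul_zero]
  · positivity
  intro x hx
  have hx' := (Finset.mem_filter.mp hx).2
  obtain ⟨r, hr⟩ := Finset.card_pos.mp (show
    0 < (Finset.univ.filter fun r => Misread 1 (x r)).card by omega)
  refine Finset.prod_eq_zero (Finset.mem_univ r) ?_
  rw [amplitude_one_eq_zero (Finset.mem_filter.mp hr).2]
  simp

/-! ### Counting applications of controlled-`U` -/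

theorem Circuit.calls_append (c d : Circuit k m) :
    Circuit.calls (c ++ d) = Circuit.calls c + Circuit.calls d := by
  simp [Circuit.calls]

theorem Circuit.calls_undo (c : Circuit k m) : c.undo.calls = c.calls := by
  have h : (Gate.calls ∘ Gate.adjoint : Gate k m → ℕ) = Gate.calls := by
    ext g; cases g <;> rfl
  simp [Circuit.calls, Circuit.undo, List.sum_reverse, h]

theorem calls_estimate (r : Fin k) : Circuit.calls (estimate (m := m) r) = 2 ^ m - 1 := by
  have h : ∀ l : List (Fin m), Circuit.calls
      (l.flatMap fun i : Fin m => List.replicate (2 ^ (i : ℕ)) (Gate.ctrl r i))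
      = (l.map fun i : Fin m => 2 ^ (i : ℕ)).sum := by
    intro l
    induction l with
    | nil => rfl
    | cons i l ih =>
      rw [List.flatMap_cons, Circuit.calls_append, ih]
      simp [Circuit.calls, Gate.calls]
  rw [estimate, Circuit.calls_append, Circuit.calls_append, h, ← List.ofFn_eq_map, List.sum_ofFn,
    Fin.sum_univ_eq_sum_range (fun i => 2 ^ i), Nat.geomSum_eq le_rfl]
  simp [Circuit.calls, Gate.calls]

theorem calls_rotateCircuit : (rotateCircuit k m).calls = 2 * (k * (2 ^ m - 1)) := by
  have h : ∀ l : List (Fin k),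
      Circuit.calls (l.flatMap (estimate (m := m))) = l.length * (2 ^ m - 1) := by
    intro l
    induction l with
    | nil => simp [Circuit.calls]
    | cons r l ih =>
      rw [List.flatMap_cons, Circuit.calls_append, ih, calls_estimate, List.length_cons]
      ring
  rw [rotateCircuit, Circuit.calls_append, Circuit.calls_append, Circuit.calls_undo, h,
    List.length_finRange]
  simp [Circuit.calls, Gate.calls]
  ring

/-- For `m > 0` minimality of `m` gives `2^(m-1) < b / Δ`. The `- 1` matters for `m = 0`: no calls
are made, and `b / Δ` may be arbitrarily small. -/
theorem two_pow_qubits_sub_one_le {b Δ : ℝ} (hb : 0 < b) (hΔ : 0 < Δ) :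
    ((2 ^ qubits b Δ - 1 : ℕ) : ℝ) ≤ 2 * (b / Δ) := by
  rw [qubits]
  have hpos : 0 < b / Δ := div_pos hb hΔ
  rcases Nat.eq_zero_or_pos (Nat.clog 2 ⌈b / Δ⌉₊) with h | h
  · rw [h]; simp; positivity
  · have h1 : 2 ^ (Nat.clog 2 ⌈b / Δ⌉₊ - 1) < ⌈b / Δ⌉₊ :=
      (Nat.lt_clog_iff_pow_lt one_lt_two).mp (by omega)
    have h2 := Nat.lt_ceil.mp h1
    have h3 : (2 : ℝ) ^ Nat.clog 2 ⌈b / Δ⌉₊ = 2 * 2 ^ (Nat.clog 2 ⌈b / Δ⌉₊ - 1) := by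
      rw [← pow_succ']; congr 1; omega
    rw [Nat.cast_sub Nat.one_le_two_pow]
    push_cast at h2 ⊢
    rw [h3]
    linarith

theorem le_two_pow_qubits (b Δ : ℝ) : b / Δ ≤ 2 ^ qubits b Δ := by
  refine (Nat.le_ceil _).trans ?_
  exact_mod_cast Nat.le_pow_clog one_lt_two _

theorem calls_Rotate_le {a b Δ ε : ℝ} (ha : 0 ≤ a) (hb : 0 < b) (hΔ : 0 < Δ) (hε : 0 < ε)
    (hε1 : ε < 1) :
    ((Rotate a b Δ ε).calls : ℝ) ≤ 4 * a * b * Real.log (1 / ε) * (1 / Δ) := by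
  have hlog : 0 ≤ Real.log (1 / ε) := Real.log_nonneg (by rw [le_div_iff₀ hε]; linarith)
  have hk : (repetitions a ε : ℝ) ≤ a * Real.log (1 / ε) := Nat.floor_le (by positivity)
  have hm := two_pow_qubits_sub_one_le hb hΔ
  rw [Rotate, calls_rotateCircuit]
  push_cast
  calc _ ≤ 2 * ((a * Real.log (1 / ε)) * (2 * (b / Δ))) := by gcongr
    _ = _ := by ring

/-- Since `a log 2 ≥ 1`, the exponent without rounding would give at most `ε`; the floor costs at
most a factor `2`. -/
theorem half_pow_repetitions_le {a ε : ℝ} (ha : 2 ≤ a) (hε : 0 < ε) (hε1 : ε < 1) :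
    (1 / 2 : ℝ) ^ repetitions a ε ≤ 2 * ε := by
  have hlog : 0 ≤ Real.log (1 / ε) := Real.log_nonneg (by rw [le_div_iff₀ hε]; linarith)
  have hk : a * Real.log (1 / ε) < repetitions a ε + 1 := Nat.lt_floor_add_one _
  have h2 : 1 / 2 < Real.log 2 := by linarith [Real.log_two_gt_d9]
  have h : Real.log ((1 / 2 : ℝ) ^ repetitions a ε) ≤ Real.log (2 * ε) := by
    rw [Real.log_pow, Real.log_mul two_ne_zero hε.ne', one_div, Real.log_inv]
    rw [one_div, Real.log_inv] at hk hlog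
    nlinarith
  exact (Real.log_le_log_iff (by positivity) (by positivity)).mp h

end Rotate

/-! ### Spectral decomposition of a unitary matrix -/

section SpectralDecomposition

variable {ι : Type u} [Fintype ι] [DecidableEq ι]

theorem mem_eigenspace_iff_mulVec {U : Matrix ι ι ℂ} {z : ℂ} {w : EuclideanSpace ℂ ι} :
    w ∈ eigenspace U z ↔ U *ᵥ w.ofLp = z • w.ofLp := by
  rw [eigenspace, Module.End.mem_eigenspace_iff]
  constructor
  · intro h
    simpa using congrArg WithLp.ofLp h
  · intro h
    ext i
    simpa using congrFun h i

theorem eigencomponent_mem (U : Matrix ι ι ℂ) (z : ℂ) (ψ : EuclideanSpace ℂ ι) :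
    eigencomponent U z ψ ∈ eigenspace U z :=
  Submodule.starProjection_apply_mem _ _

theorem eigencomponent_eq_zero {U : Matrix ι ι ℂ} {z : ℂ}
    (hz : ¬ Module.End.HasEigenvalue (Matrix.toEuclideanLin U) z) (ψ : EuclideanSpace ℂ ι) :
    eigencomponent U z ψ = 0 := by
  have h := eigencomponent_mem U z ψ
  have hbot : eigenspace U z = ⊥ := by
    rw [Module.End.HasEigenvalue, Module.End.HasUnifEigenvalue, not_not] at hz
    exact hz
  rw [hbot] at h
  exact (Submodule.mem_bot ℂ).mp h

theorem inner_toEuclideanLin {U : Matrix ι ι ℂ} (hU : Uᴴ * U = 1) (v w : EuclideanSpace ℂ ι) :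
    inner ℂ (Matrix.toEuclideanLin U v) (Matrix.toEuclideanLin U w) = inner ℂ v w := by
  rw [← LinearMap.adjoint_inner_right, ← Matrix.toEuclideanLin_conjTranspose_eq_adjoint]
  congr 1
  ext i
  simp [Matrix.mulVec_mulVec, hU]

theorem norm_eq_one_of_hasEigenvalue {U : Matrix ι ι ℂ} (hU : Uᴴ * U = 1) {z : ℂ}
    (hz : Module.End.HasEigenvalue (Matrix.toEuclideanLin U) z) : ‖z‖ = 1 := by
  obtain ⟨w, hw⟩ := hz.exists_hasEigenvector
  have h := inner_toEuclideanLin hU w w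
  rw [hw.apply_eq_smul, inner_self_eq_norm_sq_to_K, inner_self_eq_norm_sq_to_K, norm_smul] at h
  have h1 : (‖z‖ * ‖w‖) ^ 2 = ‖w‖ ^ 2 := by exact_mod_cast h
  have h2 : ‖w‖ ≠ 0 := norm_ne_zero_iff.mpr hw.2
  have h3 : ‖z‖ ^ 2 = 1 := by
    rw [mul_pow] at h1
    exact mul_right_cancel₀ (pow_ne_zero 2 h2) (by rw [h1, one_mul])
  exact (pow_eq_one_iff_of_nonneg (norm_nonneg z) two_ne_zero).mp h3

theorem conjTranspose_mulVec_of_mem_eigenspace {U : Matrix ι ι ℂ} (hU : Uᴴ * U = 1) {z : ℂ}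
    (hz : ‖z‖ = 1) {w : EuclideanSpace ℂ ι} (hw : w ∈ eigenspace U z) :
    Uᴴ *ᵥ w.ofLp = star z • w.ofLp := by
  have h := mem_eigenspace_iff_mulVec.mp hw
  have h1 : w.ofLp = z • (Uᴴ *ᵥ w.ofLp) := by
    rw [← Matrix.mulVec_smul, ← h, Matrix.mulVec_mulVec, hU, Matrix.one_mulVec]
  conv_rhs => rw [h1]
  rw [smul_smul, Complex.star_def, Complex.conj_mul', hz]
  simp

theorem inner_eq_zero_of_mem_eigenspace {U : Matrix ι ι ℂ} (hU : Uᴴ * U = 1) {z z' : ℂ}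
    (hne : z ≠ z') {w w' : EuclideanSpace ℂ ι} (hw : w ∈ eigenspace U z)
    (hw' : w' ∈ eigenspace U z') : inner ℂ w w' = 0 := by
  by_contra h0
  have hwne : w ≠ 0 := by rintro rfl; simp at h0
  have hz : ‖z‖ = 1 := norm_eq_one_of_hasEigenvalue hU
    (Module.End.hasEigenvalue_of_hasEigenvector ⟨hw, hwne⟩)
  have h := inner_toEuclideanLin hU w w'
  rw [Module.End.mem_eigenspace_iff.mp hw, Module.End.mem_eigenspace_iff.mp hw', inner_smul_left,
    inner_smul_right, ← mul_assoc] at h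
  have h1 : (starRingEnd ℂ) z * z' = 1 := mul_right_cancel₀ h0 (by rw [h, one_mul])
  have h2 : (starRingEnd ℂ) z * z = 1 := by rw [Complex.conj_mul', hz]; simp
  have h3 : (starRingEnd ℂ) z ≠ 0 := left_ne_zero_of_mul_eq_one h2
  exact hne (mul_left_cancel₀ h3 (h2.trans h1.symm))

theorem orthogonalFamily_eigenspace {U : Matrix ι ι ℂ} (hU : Uᴴ * U = 1) :
    OrthogonalFamily ℂ (fun z => eigenspace U z) fun z => (eigenspace U z).subtypeₗᵢ :=
  fun _ _ hne w w' => inner_eq_zero_of_mem_eigenspace hU hne w.2 w'.2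

/-- The orthogonal complement of all eigenspaces is invariant under the isometry `U`. If it were
nonzero it would contain an eigenvector, orthogonal to itself. -/
theorem iSup_eigenspace_eq_top {U : Matrix ι ι ℂ} (hU : Uᴴ * U = 1) :
    ⨆ z, eigenspace U z = ⊤ := by
  set K := ⨆ z, eigenspace U z with hK
  rw [← Submodule.orthogonal_eq_bot_iff]
  by_contra hne
  have hinv : ∀ x ∈ Kᗮ, Matrix.toEuclideanLin U x ∈ Kᗮ := by
    intro x hx
    rw [hK, ← Submodule.iInf_orthogonal, Submodule.mem_iInf] at hx ⊢
    intro z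
    rw [Submodule.mem_orthogonal]
    intro w hw
    by_cases hw0 : w = 0
    · simp [hw0]
    have hz : ‖z‖ = 1 := norm_eq_one_of_hasEigenvalue hU
      (Module.End.hasEigenvalue_of_hasEigenvector ⟨hw, hw0⟩)
    have hz0 : (starRingEnd ℂ) z ≠ 0 := by
      rw [Ne, map_eq_zero]; rintro rfl; simp at hz
    have h := inner_toEuclideanLin hU w x
    rw [Module.End.mem_eigenspace_iff.mp hw, inner_smul_left,
      (Submodule.mem_orthogonal _ _).mp (hx z) w hw] at h
    exact (mul_eq_zero.mp h).resolve_left hz0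
  have : Nontrivial Kᗮ := Submodule.nontrivial_iff_ne_bot.mpr hne
  obtain ⟨z, hz⟩ := Module.End.exists_eigenvalue ((Matrix.toEuclideanLin U).restrict hinv)
  obtain ⟨v, hv⟩ := hz.exists_hasEigenvector
  have hvK : (v : EuclideanSpace ℂ ι) ∈ K := by
    refine Submodule.mem_iSup_of_mem z ?_
    rw [eigenspace, Module.End.mem_eigenspace_iff]
    simpa using congrArg Subtype.val hv.apply_eq_smul
  have h0 : (v : EuclideanSpace ℂ ι) = 0 := by
    have h := (Submodule.mem_orthogonal _ _).mp v.2 v hvK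
    exact inner_self_eq_zero.mp h
  exact hv.2 (Subtype.ext h0)

/-- The eigenvalues of `U`. -/
def eigenvalueFinset (U : Matrix ι ι ℂ) : Finset ℂ :=
  (Module.End.finite_hasEigenvalue (Matrix.toEuclideanLin U)).toFinset

theorem mem_eigenvalueFinset {U : Matrix ι ι ℂ} {z : ℂ} :
    z ∈ eigenvalueFinset U ↔ Module.End.HasEigenvalue (Matrix.toEuclideanLin U) z := by
  simp [eigenvalueFinset]

theorem sum_eigencomponent {U : Matrix ι ι ℂ} (hU : Uᴴ * U = 1) (ψ : EuclideanSpace ℂ ι) :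
    ∑ z ∈ eigenvalueFinset U, eigencomponent U z ψ = ψ := by
  have hV := (orthogonalFamily_eigenspace hU).comp
    (Subtype.val_injective (p := fun z => z ∈ eigenvalueFinset U))
  have hmem : ψ ∈ ⨆ z : {z // z ∈ eigenvalueFinset U}, eigenspace U z := by
    have htop : ⨆ z : {z // z ∈ eigenvalueFinset U}, eigenspace U z = ⊤ := by
      rw [eq_top_iff, ← iSup_eigenspace_eq_top hU]
      refine iSup_le fun z => ?_
      by_cases hz : z ∈ eigenvalueFinset U
      · exact le_iSup (fun z : {z // z ∈ eigenvalueFinset U} => eigenspace U z) ⟨z, hz⟩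
      · rw [mem_eigenvalueFinset, Module.End.HasEigenvalue, Module.End.HasUnifEigenvalue,
          not_not] at hz
        exact (le_of_eq hz).trans bot_le
    rw [htop]; trivial
  have h := hV.sum_projection_of_mem_iSup ψ hmem
  rw [← Finset.sum_coe_sort]
  exact h

theorem sum_norm_sq_eigencomponent {U : Matrix ι ι ℂ} (hU : Uᴴ * U = 1)
    (ψ : EuclideanSpace ℂ ι) :
    ∑ z ∈ eigenvalueFinset U, ‖eigencomponent U z ψ‖ ^ 2 = ‖ψ‖ ^ 2 := by
  have h := (orthogonalFamily_eigenspace hU).norm_sum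
    (fun z => ⟨eigencomponent U z ψ, eigencomponent_mem U z ψ⟩) (eigenvalueFinset U)
  conv_rhs => rw [← sum_eigencomponent hU ψ]
  exact h.symm

end SpectralDecomposition

/-! ### Real matrices -/

section RealMatrix

variable {ι : Type u} [Fintype ι] [DecidableEq ι]

/-- The entrywise complex conjugate of a vector. -/
def conjVec {κ : Type*} (w : EuclideanSpace ℂ κ) : EuclideanSpace ℂ κ := WithLp.toLp 2 (star w.ofLp)

theorem norm_conjVec {κ : Type*} [Fintype κ] (w : EuclideanSpace ℂ κ) : ‖conjVec w‖ = ‖w‖ := by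
  simp [conjVec, EuclideanSpace.norm_eq]

theorem inner_conjVec {κ : Type*} [Fintype κ] (v w : EuclideanSpace ℂ κ) :
    inner ℂ (conjVec v) w = (starRingEnd ℂ) (inner ℂ v (conjVec w)) := by
  simp [conjVec, PiLp.inner_apply, map_sum]

theorem conjVec_mem_eigenspace {U : Matrix ι ι ℂ} (hreal : U.map star = U) {z : ℂ}
    {w : EuclideanSpace ℂ ι} (hw : w ∈ eigenspace U z) :
    conjVec w ∈ eigenspace U ((starRingEnd ℂ) z) := by
  rw [mem_eigenspace_iff_mulVec] at hw ⊢
  ext i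
  have h := congrArg star (congrFun hw i)
  have hU : ∀ j, star (U i j) = U i j := fun j => congrFun (congrFun hreal i) j
  simp only [Matrix.mulVec, dotProduct, star_sum, Pi.smul_apply, smul_eq_mul, star_mul', hU] at h
  simpa [conjVec, Matrix.mulVec, dotProduct] using h

/-- Conjugation is antiunitary and exchanges the two eigenspaces of a real matrix, so it carries one
projection to the other. Hence conjugate components have equal norms, which accounts for the weight
`2 δ_j²` in `lawQH`. -/
theorem eigencomponent_conj {U : Matrix ι ι ℂ} (hreal : U.map star = U)
    {ψ : EuclideanSpace ℂ ι} (hψ : conjVec ψ = ψ) (z : ℂ) :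
    eigencomponent U ((starRingEnd ℂ) z) ψ = conjVec (eigencomponent U z ψ) := by
  refine Submodule.eq_starProjection_of_mem_of_inner_eq_zero
    (conjVec_mem_eigenspace hreal (eigencomponent_mem U z ψ)) fun w hw => ?_
  have hw' : conjVec w ∈ eigenspace U z := by
    simpa using conjVec_mem_eigenspace hreal hw
  have h1 : ψ - conjVec (eigencomponent U z ψ) = conjVec (ψ - eigencomponent U z ψ) := by
    nth_rw 1 [← hψ]
    ext i
    simp [conjVec]
  rw [h1, inner_conjVec]
  have h2 : inner ℂ (ψ - eigencomponent U z ψ) (conjVec w) = 0 :=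
    Submodule.starProjection_inner_eq_zero ψ (conjVec w) hw'
  rw [h2, map_zero]

theorem hasEigenvalue_conj {U : Matrix ι ι ℂ} (hreal : U.map star = U) {z : ℂ}
    (hz : Module.End.HasEigenvalue (Matrix.toEuclideanLin U) z) :
    Module.End.HasEigenvalue (Matrix.toEuclideanLin U) ((starRingEnd ℂ) z) := by
  obtain ⟨w, hw⟩ := hz.exists_hasEigenvector
  refine Module.End.hasEigenvalue_of_hasEigenvector
    (x := conjVec w) ⟨conjVec_mem_eigenspace hreal hw.1, fun h => hw.2 ?_⟩
  rw [← norm_eq_zero, ← norm_conjVec, h, norm_zero]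

theorem mem_upperEigenvalues {U : Matrix ι ι ℂ} {z : ℂ} :
    z ∈ upperEigenvalues U ↔
      Module.End.HasEigenvalue (Matrix.toEuclideanLin U) z ∧ 0 < z.im := by
  simp [upperEigenvalues]

theorem not_hasEigenvalue_neg_one {U : Matrix ι ι ℂ} (hphase : PhasesAtMostHalfPi U) :
    ¬ Module.End.HasEigenvalue (Matrix.toEuclideanLin U) (-1) := by
  intro h
  have h1 := hphase _ h
  rw [Complex.arg_neg_one, abs_of_pos Real.pi_pos] at h1
  linarith [Real.pi_pos]

/-- A sum over the eigenvalues of a real orthogonal matrix, arranged by conjugate pairs. -/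
theorem sum_eigenvalueFinset {U : Matrix ι ι ℂ} (hU : Uᴴ * U = 1) (hreal : U.map star = U)
    (hphase : PhasesAtMostHalfPi U) {M : Type*} [AddCommMonoid M] (F : ℂ → M)
    (hF : ∀ z, ¬ Module.End.HasEigenvalue (Matrix.toEuclideanLin U) z → F z = 0) :
    ∑ z ∈ eigenvalueFinset U, F z
      = F 1 + ∑ z ∈ upperEigenvalues U, (F z + F ((starRingEnd ℂ) z)) := by
  have hupper : ∑ z ∈ eigenvalueFinset U with 0 < z.im, F z = ∑ z ∈ upperEigenvalues U, F z := rfl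
  have hlower : ∑ z ∈ (eigenvalueFinset U).filter (fun z => ¬ 0 < z.im) with z.im < 0, F z
      = ∑ z ∈ upperEigenvalues U, F ((starRingEnd ℂ) z) := by
    refine Finset.sum_nbij' (fun z => (starRingEnd ℂ) z) (fun z => (starRingEnd ℂ) z)
      ?_ ?_ (by simp) (by simp) (by simp)
    · intro z hz
      simp only [Finset.mem_filter, mem_eigenvalueFinset] at hz
      exact mem_upperEigenvalues.mpr ⟨hasEigenvalue_conj hreal hz.1.1, by simpa using hz.2⟩
    · intro z hz
      obtain ⟨h1, h2⟩ := mem_upperEigenvalues.mp hz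
      simp only [Finset.mem_filter, mem_eigenvalueFinset, Complex.conj_im]
      exact ⟨⟨hasEigenvalue_conj hreal h1, by linarith⟩, by linarith⟩
  have hone : ∑ z ∈ (eigenvalueFinset U).filter (fun z => ¬ 0 < z.im) with ¬ z.im < 0, F z
      = F 1 := by
    rw [← Finset.sum_singleton F 1]
    refine Finset.sum_subset ?_ ?_
    · intro z hz
      simp only [Finset.mem_filter, mem_eigenvalueFinset] at hz
      obtain ⟨⟨h1, h2⟩, h3⟩ := hz
      have him : z.im = 0 := le_antisymm (not_lt.mp h2) (not_lt.mp h3)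
      have hre : z = (z.re : ℂ) := Complex.ext rfl (by simp [him])
      have hn := norm_eq_one_of_hasEigenvalue hU h1
      rw [hre, Complex.norm_real, Real.norm_eq_abs] at hn
      rcases eq_or_eq_neg_of_abs_eq hn with h | h
      · rw [Finset.mem_singleton, hre, h, Complex.ofReal_one]
      · rw [hre, h, Complex.ofReal_neg, Complex.ofReal_one] at h1
        exact absurd h1 (not_hasEigenvalue_neg_one hphase)
    · intro z hz hz'
      rw [Finset.mem_singleton] at hz
      subst hz
      -- The term at `1` is harmless even when `1` is not an eigenvalue.
      refine hF 1 fun h => hz' ?_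
      simp [mem_eigenvalueFinset, h]
  rw [← Finset.sum_filter_add_sum_filter_not (eigenvalueFinset U) (fun z => 0 < z.im),
    ← Finset.sum_filter_add_sum_filter_not ((eigenvalueFinset U).filter (fun z => ¬ 0 < z.im))
      (fun z => z.im < 0), hupper, hlower, hone, Finset.sum_add_distrib]
  abel

end RealMatrix

/-! ### Product states -/

section ProductState

variable {ι κ : Type*}

/-- The product state `w ⊗ χ`. -/
def tensor (χ : κ → ℂ) : EuclideanSpace ℂ ι →ₗ[ℂ] EuclideanSpace ℂ (ι × κ) where
  toFun w := WithLp.toLp 2 (fun p => w p.1 * χ p.2)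
  map_add' v w := by ext p; simp [add_mul]
  map_smul' c w := by ext p; simp [mul_assoc]

theorem tensor_apply (χ : κ → ℂ) (w : EuclideanSpace ℂ ι) (p : ι × κ) :
    tensor χ w p = w p.1 * χ p.2 := rfl

theorem tensor_sub_smul (χ χ' : κ → ℂ) (c : ℂ) (w : EuclideanSpace ℂ ι) :
    tensor χ w - tensor χ' (c • w) = tensor (χ - c • χ') w := by
  ext p
  simp only [tensor_apply, PiLp.sub_apply, PiLp.smul_apply, Pi.sub_apply, Pi.smul_apply,
    smul_eq_mul]
  ring

theorem inner_tensor [Fintype ι] [Fintype κ] (χ χ' : κ → ℂ) (w w' : EuclideanSpace ℂ ι) :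
    inner ℂ (tensor χ w) (tensor χ' w')
      = inner ℂ w w' * ∑ x, (starRingEnd ℂ) (χ x) * χ' x := by
  simp only [PiLp.inner_apply, Fintype.sum_prod_type, tensor_apply, RCLike.inner_apply, map_mul]
  rw [Finset.sum_mul_sum]
  refine Finset.sum_congr rfl fun i _ => Finset.sum_congr rfl fun x _ => ?_
  ring

theorem norm_sq_tensor [Fintype ι] [Fintype κ] (χ : κ → ℂ) (w : EuclideanSpace ℂ ι) :
    ‖tensor χ w‖ ^ 2 = ‖w‖ ^ 2 * ∑ x, ‖χ x‖ ^ 2 := by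
  simp only [EuclideanSpace.norm_sq_eq, Fintype.sum_prod_type, tensor_apply, norm_mul, mul_pow]
  rw [Finset.sum_mul_sum]

/-- Orthogonality of the first factors alone suffices, whatever the workspace states are. -/
theorem norm_sq_sum_tensor [Fintype ι] [Fintype κ] {s : Finset ℂ} {w : ℂ → EuclideanSpace ℂ ι}
    (hw : ∀ z z', z ≠ z' → inner ℂ (w z) (w z') = 0) (χ : ℂ → κ → ℂ) :
    ‖∑ z ∈ s, tensor (χ z) (w z)‖ ^ 2 = ∑ z ∈ s, ‖w z‖ ^ 2 * ∑ x, ‖χ z x‖ ^ 2 := by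
  have h : inner ℂ (∑ z ∈ s, tensor (χ z) (w z)) (∑ z ∈ s, tensor (χ z) (w z))
      = ∑ z ∈ s, inner ℂ (tensor (χ z) (w z)) (tensor (χ z) (w z)) := by
    rw [sum_inner]
    refine Finset.sum_congr rfl fun z hz => ?_
    rw [inner_sum, Finset.sum_eq_single_of_mem z hz]
    intro z' _ hne
    rw [inner_tensor, hw z z' hne.symm, zero_mul]
  simp only [inner_self_eq_norm_sq_to_K] at h
  have h' : ‖∑ z ∈ s, tensor (χ z) (w z)‖ ^ 2 = ∑ z ∈ s, ‖tensor (χ z) (w z)‖ ^ 2 := by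
    exact_mod_cast h
  rw [h']
  exact Finset.sum_congr rfl fun z _ => norm_sq_tensor _ _

end ProductState

/-! ### Running circuits on eigenvectors, and the total error -/

section Run

variable {ι : Type u} [Fintype ι] [DecidableEq ι] {k m : ℕ}

theorem withZeros_eq_tensor {κ : Type*} [Fintype κ] (ψ : EuclideanSpace ℂ κ) :
    withZeros k m ψ = tensor (zeroState k m) ψ := by
  ext p
  simp [withZeros, tensor_apply, zeroState]

theorem blockDiagonal_toEuclideanLin_tensor {κ : Type*} [Fintype κ] [DecidableEq κ]
    (M : κ → Matrix ι ι ℂ) (d χ : κ → ℂ) {w : EuclideanSpace ℂ ι}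
    (hM : ∀ x, M x *ᵥ w.ofLp = d x • w.ofLp) :
    Matrix.toEuclideanLin (Matrix.blockDiagonal M) (tensor χ w)
      = tensor (Matrix.diagonal d *ᵥ χ) w := by
  ext ⟨i, x⟩
  rw [tensor_apply, Matrix.mulVec_diagonal, Matrix.toLpLin_apply]
  change (Matrix.blockDiagonal M *ᵥ _) (i, x) = _
  rw [Matrix.mulVec, dotProduct, Fintype.sum_prod_type]
  have h := congrFun (hM x) i
  simp only [Matrix.mulVec, dotProduct, Pi.smul_apply, smul_eq_mul] at h
  have h1 : ∀ j, ∑ y, Matrix.blockDiagonal M (i, x) (j, y) * tensor χ w (j, y)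
      = M x i j * w j * χ x := by
    intro j
    rw [Finset.sum_eq_single x]
    · rw [Matrix.blockDiagonal_apply, if_pos rfl, tensor_apply, mul_assoc]
    · intro y _ hy
      rw [Matrix.blockDiagonal_apply, if_neg hy.symm, zero_mul]
    · simp
  rw [Finset.sum_congr rfl fun j _ => h1 j, ← Finset.sum_mul, h]
  ring

theorem kronecker_toEuclideanLin_tensor {κ : Type*} [Fintype κ] [DecidableEq κ]
    (W : Matrix κ κ ℂ) (χ : κ → ℂ) (w : EuclideanSpace ℂ ι) :
    Matrix.toEuclideanLin ((1 : Matrix ι ι ℂ) ⊗ₖ W) (tensor χ w) = tensor (W *ᵥ χ) w := by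
  ext ⟨i, x⟩
  rw [tensor_apply, Matrix.toLpLin_apply]
  change (((1 : Matrix ι ι ℂ) ⊗ₖ W) *ᵥ _) (i, x) = _
  rw [Matrix.mulVec, dotProduct,
    Fintype.sum_prod_type, Finset.sum_eq_single i]
  · simp only [Matrix.kronecker_apply, Matrix.one_apply_eq, one_mul, tensor_apply, Matrix.mulVec,
      dotProduct, Finset.mul_sum]
    exact Finset.sum_congr rfl fun y _ => by ring
  · intro j _ hj
    simp [Matrix.one_apply_ne hj.symm]
  · simp

theorem Gate.toEuclideanLin_mat_tensor {U : Matrix ι ι ℂ} {z : ℂ} {w : EuclideanSpace ℂ ι}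
    (h : U *ᵥ w.ofLp = z • w.ofLp) (h' : Uᴴ *ᵥ w.ofLp = star z • w.ofLp) (g : Gate k m)
    (χ : Work k m → ℂ) :
    Matrix.toEuclideanLin (g.mat U) (tensor χ w) = tensor (g.scalarMat z *ᵥ χ) w := by
  cases g with
  | work W => exact kronecker_toEuclideanLin_tensor W χ w
  | ctrl r i =>
    refine blockDiagonal_toEuclideanLin_tensor _ _ χ fun x => ?_
    split_ifs <;> simp [h]
  | ctrlInv r i =>
    refine blockDiagonal_toEuclideanLin_tensor _ _ χ fun x => ?_
    split_ifs <;> simp [h']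

/-- The condition on `Uᴴ` serves the inverse calls made when the phase estimations are undone. -/
theorem Circuit.run_tensor {U : Matrix ι ι ℂ} {z : ℂ} {w : EuclideanSpace ℂ ι}
    (h : U *ᵥ w.ofLp = z • w.ofLp) (h' : Uᴴ *ᵥ w.ofLp = star z • w.ofLp) (c : Circuit k m)
    (χ : Work k m → ℂ) :
    c.run U (tensor χ w) = tensor (Circuit.scalarMat z c *ᵥ χ) w := by
  induction c generalizing χ with
  | nil =>
    ext p
    simp [Circuit.run, Circuit.mat, Circuit.scalarMat]
  | cons g c ih =>
    have hcomp : Circuit.run U (g :: c) (tensor χ w)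
        = Circuit.run U c (Matrix.toEuclideanLin (g.mat U) (tensor χ w)) := by
      ext p
      simp [Circuit.run, Circuit.mat, Matrix.mulVec_mulVec]
    rw [hcomp, Gate.toEuclideanLin_mat_tensor h h', ih, Circuit.scalarMat, Matrix.mulVec_mulVec]

theorem rotation_eq_sum {U : Matrix ι ι ℂ} (hU : Uᴴ * U = 1) (hreal : U.map star = U)
    (hphase : PhasesAtMostHalfPi U) (ψ : EuclideanSpace ℂ ι) :
    rotation U ψ = ∑ z ∈ eigenvalueFinset U, phaseSign z • eigencomponent U z ψ := by
  rw [sum_eigenvalueFinset hU hreal hphase _ fun z hz => by rw [eigencomponent_eq_zero hz,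
    smul_zero], rotation, eigencomponent_eq_zero (not_hasEigenvalue_neg_one hphase), add_zero]
  congr 1
  · simp [phaseSign]
  · refine Finset.sum_congr rfl fun z hz => ?_
    have him := (mem_upperEigenvalues.mp hz).2
    rw [phaseSign, phaseSign, if_pos (Complex.arg_nonneg_iff.mpr him.le),
      if_neg (by rw [Complex.arg_nonneg_iff, Complex.conj_im]; linarith), one_smul, neg_one_smul,
      sub_eq_add_neg]

/-- The squared error of the rotation procedure is the average of those on the eigenvectors. -/
theorem norm_sq_run_sub_rotation {U : Matrix ι ι ℂ} (hU : Uᴴ * U = 1) (hreal : U.map star = U)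
    (hphase : PhasesAtMostHalfPi U) (ψ : EuclideanSpace ℂ ι) :
    ‖(rotateCircuit k m).run U (withZeros k m ψ) - withZeros k m (rotation U ψ)‖ ^ 2
      = ∑ z ∈ eigenvalueFinset U,
          ‖eigencomponent U z ψ‖ ^ 2 * ∑ x, ‖rotationDefect k m z x‖ ^ 2 := by
  rw [← norm_sq_sum_tensor fun z z' hne => inner_eq_zero_of_mem_eigenspace hU hne
    (eigencomponent_mem U z ψ) (eigencomponent_mem U z' ψ)]
  congr 2
  rw [rotation_eq_sum hU hreal hphase, withZeros_eq_tensor, withZeros_eq_tensor]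
  nth_rw 1 [← sum_eigencomponent hU ψ]
  rw [Circuit.run, map_sum, map_sum, map_sum, ← Finset.sum_sub_distrib]
  refine Finset.sum_congr rfl fun z hz => ?_
  have hz1 := norm_eq_one_of_hasEigenvalue hU (mem_eigenvalueFinset.mp hz)
  have h := Circuit.run_tensor (mem_eigenspace_iff_mulVec.mp (eigencomponent_mem U z ψ))
    (conjTranspose_mulVec_of_mem_eigenspace hU hz1 (eigencomponent_mem U z ψ))
    (rotateCircuit k m) (zeroState k m)
  rw [Circuit.run] at h
  rw [h, tensor_sub_smul, rotationDefect]

/-! ### The quantum hitting time -/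

/-- Discarding the atoms at `1 / π` and `0` only decreases the tail of `lawQH`. -/
theorem sum_small_phases_le {U : Matrix ι ι ℂ} {ψ : EuclideanSpace ℂ ι} {T ε : ℝ} (hε : 0 ≤ ε)
    (h : lawQH U ψ (Set.Ioi T) ≤ ENNReal.ofReal ε) :
    ∑ z ∈ upperEigenvalues U with T < 1 / z.arg, 2 * ‖eigencomponent U z ψ‖ ^ 2 ≤ ε := by
  rw [← ENNReal.ofReal_le_ofReal_iff hε]
  have hle : (∑ z ∈ upperEigenvalues U, ENNReal.ofReal (2 * ‖eigencomponent U z ψ‖ ^ 2) •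
      Measure.dirac (1 / z.arg)) (Set.Ioi T) ≤ lawQH U ψ (Set.Ioi T) := by
    rw [lawQH, Measure.add_apply, Measure.add_apply, add_assoc]
    exact le_self_add
  refine le_trans (le_of_eq ?_) (hle.trans h)
  rw [ENNReal.ofReal_sum_of_nonneg fun z _ => by positivity, Finset.sum_filter,
    Measure.finsetSum_apply]
  refine Finset.sum_congr rfl fun z _ => ?_
  rw [Measure.smul_apply, Measure.dirac_apply' _ measurableSet_Ioi, smul_eq_mul]
  by_cases hz : T < 1 / z.arg
  · rw [if_pos hz, Set.indicator_of_mem (Set.mem_Ioi.mpr hz)]; simp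
  · rw [if_neg hz, Set.indicator_of_notMem (by simpa using hz)]; simp

/-- Conjugate pairs are split at the phase `1 / T`: larger phases are resolved by the precision,
smaller ones are rare by the tail hypothesis. -/
theorem norm_sq_run_sub_rotation_le {U : Matrix ι ι ℂ} (hU : Uᴴ * U = 1)
    (hreal : U.map star = U) (hphase : PhasesAtMostHalfPi U) {ψ : EuclideanSpace ℂ ι}
    (hψ : conjVec ψ = ψ) {T ε : ℝ} (hε : 0 ≤ ε)
    (htail : lawQH U ψ (Set.Ioi T) ≤ ENNReal.ofReal ε) (hprec : 74 * Real.pi * T ≤ 2 ^ m) :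
    ‖(rotateCircuit k m).run U (withZeros k m ψ) - withZeros k m (rotation U ψ)‖ ^ 2
      ≤ 4 * (1 / 2) ^ k * ‖ψ‖ ^ 2 + 4 * ε := by
  have hzero : ∀ z, ¬ Module.End.HasEigenvalue (Matrix.toEuclideanLin U) z →
      ‖eigencomponent U z ψ‖ ^ 2 = 0 := fun z hz => by rw [eigencomponent_eq_zero hz]; simp
  have hconj : ∀ z, ‖eigencomponent U ((starRingEnd ℂ) z) ψ‖ = ‖eigencomponent U z ψ‖ :=
    fun z => by rw [eigencomponent_conj hreal hψ, norm_conjVec]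
  rw [norm_sq_run_sub_rotation hU hreal hphase, ← sum_norm_sq_eigencomponent hU,
    sum_eigenvalueFinset hU hreal hphase _ fun z hz => by rw [hzero z hz, zero_mul],
    sum_eigenvalueFinset hU hreal hphase _ hzero, mul_add, add_assoc]
  have hpair : ∀ z ∈ upperEigenvalues U,
      ‖eigencomponent U z ψ‖ ^ 2 * ∑ x, ‖rotationDefect k m z x‖ ^ 2
        + ‖eigencomponent U ((starRingEnd ℂ) z) ψ‖ ^ 2
          * ∑ x, ‖rotationDefect k m ((starRingEnd ℂ) z) x‖ ^ 2
      ≤ 4 * (1 / 2) ^ k * (‖eigencomponent U z ψ‖ ^ 2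
          + ‖eigencomponent U ((starRingEnd ℂ) z) ψ‖ ^ 2)
        + 4 * (if T < 1 / z.arg then 2 * ‖eigencomponent U z ψ‖ ^ 2 else 0) := by
    intro z hz
    obtain ⟨hev, him⟩ := mem_upperEigenvalues.mp hz
    have hz1 := norm_eq_one_of_hasEigenvalue hU hev
    have hz1' := norm_eq_one_of_hasEigenvalue hU (hasEigenvalue_conj hreal hev)
    have harg := hphase z hev
    have harg' := hphase _ (hasEigenvalue_conj hreal hev)
    have hpos : 0 < z.arg := lt_of_le_of_ne (Complex.arg_nonneg_iff.mpr him.le)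
      fun h => him.ne' (Complex.arg_eq_zero_iff.mp h.symm).2
    have habs : |((starRingEnd ℂ) z).arg| = |z.arg| := by
      rw [Complex.arg_conj, if_neg, abs_neg]
      intro h
      rw [h, abs_of_pos Real.pi_pos] at harg
      linarith [Real.pi_pos]
    rw [hconj]
    have hc : 0 ≤ ‖eigencomponent U z ψ‖ ^ 2 := by positivity
    -- First the phases below `1 / T`: both members of the pair have defect at most `4`. Otherwise
    -- `T · arg z ≥ 1`, and the precision hypothesis gives `2^m |arg z| ≥ 74π`.
    split_ifs with hs
    · have h1 := sum_norm_sq_rotationDefect_le_four (k := k) (m := m) hz1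
      have h2 := sum_norm_sq_rotationDefect_le_four (k := k) (m := m) hz1'
      have h3 : (0 : ℝ) ≤ 4 * (1 / 2) ^ k * (‖eigencomponent U z ψ‖ ^ 2
          + ‖eigencomponent U z ψ‖ ^ 2) := by positivity
      nlinarith [mul_le_mul_of_nonneg_left h1 hc, mul_le_mul_of_nonneg_left h2 hc]
    · have hTa : 1 ≤ T * z.arg := by
        rw [not_lt, div_le_iff₀ hpos] at hs; exact hs
      have hpr : 74 * Real.pi ≤ 2 ^ m * |z.arg| := by
        rw [abs_of_pos hpos]
        calc 74 * Real.pi ≤ 74 * Real.pi * (T * z.arg) :=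
              le_mul_of_one_le_right (by positivity) hTa
          _ = 74 * Real.pi * T * z.arg := by ring
          _ ≤ 2 ^ m * z.arg := by gcongr
      have h1 := sum_norm_sq_rotationDefect_le_pow (k := k) hz1 harg hpr
      have h2 := sum_norm_sq_rotationDefect_le_pow (k := k) hz1' harg' (by rw [habs]; exact hpr)
      have h3 := mul_le_mul_of_nonneg_left h1 hc
      have h4 := mul_le_mul_of_nonneg_left h2 hc
      linarith
  have hsmall := sum_small_phases_le hε htail
  rw [Finset.sum_filter] at hsmall
  refine add_le_add ?_ ((Finset.sum_le_sum hpair).trans ?_)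
  · rw [mul_comm]
    gcongr
    exact sum_norm_sq_rotationDefect_one_le
  · rw [Finset.sum_add_distrib, ← Finset.mul_sum, ← Finset.mul_sum]
    gcongr

end Run

/-! ### Abstract search -/

namespace AbstractSearch

variable {ι : Type u} [Fintype ι] [DecidableEq ι] (S : AbstractSearch ι)

theorem U₁_mem : S.U₁ ∈ Matrix.orthogonalGroup ι ℝ := by
  have hμ : (fun i => S.μ i) ⬝ᵥ (fun i => S.μ i) = 1 := by
    have h := EuclideanSpace.real_norm_sq_eq S.μ
    rw [S.norm_μ] at h
    rw [dotProduct]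
    simp only [← sq]
    linarith
  have ht : S.U₁ᵀ = S.U₁ := by
    rw [U₁,
      Matrix.transpose_sub, Matrix.transpose_one, Matrix.transpose_smul,
      Matrix.transpose_vecMulVec]
  rw [Matrix.mem_orthogonalGroup_iff, ht, U₁, sub_mul, mul_sub, mul_sub, one_mul, mul_one, one_mul,
    Matrix.smul_mul, Matrix.mul_smul, Matrix.vecMulVec_mul_vecMulVec, hμ, one_smul]
  rw [smul_smul]
  module

theorem conjTranspose_U_mul_U : (S.U)ᴴ * S.U = 1 := by
  have h := mul_eq_one_comm.mp
    ((Matrix.mem_orthogonalGroup_iff ι ℝ).mp (mul_mem S.U₂_mem S.U₁_mem))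
  have hmap : (S.U)ᴴ = ((S.U₂ * S.U₁)ᵀ).map Complex.ofRealHom := by
    ext i j
    simp only [U, Matrix.conjTranspose_apply, Matrix.map_apply, Matrix.transpose_apply,
      Complex.star_def, Complex.conj_ofReal, Complex.ofRealHom_eq_coe]
  have hU : S.U = (S.U₂ * S.U₁).map Complex.ofRealHom := rfl
  rw [hmap, hU, ← Matrix.map_mul, h, Matrix.map_one _ (map_zero _) (map_one _)]

theorem U_map_star : (S.U).map star = S.U := by
  ext i j
  simp [U]

theorem conjVec_start : conjVec S.start = S.start := by
  ext i
  simp [conjVec, start]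

theorem norm_start_le : ‖S.start‖ ≤ 1 := by
  have h1 : ‖S.start‖ = ‖S.φ₀ - (inner ℝ S.φ₀ S.μ) • S.μ‖ := by
    rw [EuclideanSpace.norm_eq, EuclideanSpace.norm_eq]
    simp only [start, Complex.norm_real]
  have h2 : ‖S.φ₀ - (inner ℝ S.φ₀ S.μ) • S.μ‖ ^ 2 = 1 - (inner ℝ S.φ₀ S.μ) ^ 2 := by
    rw [norm_sub_sq_real, inner_smul_right, norm_smul, mul_pow, S.norm_φ₀, S.norm_μ,
      Real.norm_eq_abs, sq_abs]
    ring
  rw [h1]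
  nlinarith [norm_nonneg (S.φ₀ - (inner ℝ S.φ₀ S.μ) • S.μ), sq_nonneg (inner ℝ S.φ₀ S.μ)]

/-- Tails decrease in `T`, and the hitting time is an attained minimum. -/
theorem lawQH_Ioi_le {T ε : ℝ} (hε : 0 < ε) (hT : S.hittingTime ε ≤ T) :
    lawQH S.U S.start (Set.Ioi T) ≤ ENNReal.ofReal ε :=
  (measure_mono (Set.Ioi_subset_Ioi hT)).trans (S.hittingTime_isLeast hε).1.2

end AbstractSearch

end

end QuantumSearch

theorem mainTheorem8 :
    ∃ a₀ b₀ : ℝ, 0 < a₀ ∧ 0 < b₀ ∧ ∀ a b : ℝ, a₀ ≤ a → b₀ ≤ b →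
      ∃ C : ℝ, 0 < C ∧
        ∀ {ι : Type*} [Fintype ι] [DecidableEq ι] (S : QuantumSearch.AbstractSearch ι),
          QuantumSearch.PhasesAtMostHalfPi S.U →
          ∀ ε : ℝ, 0 < ε → ε < 1 →
          ∀ T : ℝ, 0 < T → S.hittingTime ε ≤ T →
            ‖(QuantumSearch.Rotate a b (1 / T) ε).run S.U (QuantumSearch.withZeros _ _ S.start)
                - QuantumSearch.withZeros _ _ (QuantumSearch.rotation S.U S.start)‖
                ≤ C * Real.sqrt ε
              ∧ ((QuantumSearch.Rotate a b (1 / T) ε).calls : ℝ) ≤ C * Real.log (1 / ε) * T :=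
  by
  -- Here `240` exceeds `74π`, and `2` exceeds `1 / log 2`. In `C`, the summand `4` serves the
  -- distance and `4 a b` the number of calls.
  refine ⟨2, 240, by norm_num, by norm_num, fun a b ha hb => ⟨4 + 4 * a * b, by positivity, ?_⟩⟩
  intro ι _ _ S hphase ε hε hε1 T hT hhit
  have ha0 : 0 ≤ a := by linarith
  have hb0 : 0 < b := by linarith
  have hlog : 0 ≤ Real.log (1 / ε) := Real.log_nonneg (by rw [le_div_iff₀ hε]; linarith)
  constructor
  · have hprec : 74 * Real.pi * T ≤ 2 ^ QuantumSearch.qubits b (1 / T) := by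
      refine le_trans ?_ (QuantumSearch.le_two_pow_qubits b (1 / T))
      rw [div_div_eq_mul_div, div_one]
      gcongr
      linarith [Real.pi_lt_d2]
    have h := QuantumSearch.norm_sq_run_sub_rotation_le (k := QuantumSearch.repetitions a ε)
      S.conjTranspose_U_mul_U S.U_map_star hphase S.conjVec_start hε.le
      (S.lawQH_Ioi_le hε hhit) hprec
    have hk := QuantumSearch.half_pow_repetitions_le ha hε hε1
    have hs : ‖S.start‖ ^ 2 ≤ 1 := pow_le_one₀ (norm_nonneg _) S.norm_start_le
    have hk0 : (0 : ℝ) ≤ (1 / 2) ^ QuantumSearch.repetitions a ε := by positivity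
    -- The squared error is at most `4 · 2ε + 4ε = 12ε`, rounded up to the square `16ε`.
    have hsq : (4 * Real.sqrt ε) ^ 2 = 16 * ε := by rw [mul_pow, Real.sq_sqrt hε.le]; norm_num
    have h4 := abs_le_of_sq_le_sq (h.trans (by rw [hsq]; nlinarith)) (by positivity)
    refine (le_abs_self _).trans (h4.trans ?_)
    gcongr
    have : 0 ≤ a * b := by positivity
    linarith
  · refine (QuantumSearch.calls_Rotate_le ha0 hb0 (one_div_pos.mpr hT) hε hε1).trans ?_
    rw [one_div_one_div]
    gcongr
    linarith
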